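/- For $x,y\in\mathbb C$ let $P(x,y)=\int_0^\infty e^{-t^4-xt^2}\cos(yt)\,dt$. Arguments and powers of $y$ are principal, and $\theta=\arg y$. Put $f(t)=e^{4i\theta/3}(it-t^4)$, $t_1=4^{-1/3}e^{i\pi/6}$, $t_2=4^{-1/3}e^{5i\pi/6}$, and consider the lines $C_1=\{t_1+re^{-i(\pi+4\theta)/6}:r\in\mathbb R\}$ and $C_2=\{t_2+re^{i(\pi-4\theta)/6}:r\in\mathbb R\}$, oriented by increasing $r$. For $y\neq0$ with $\operatorname{Re}y\ge 0$ define $$P_k(x,y)=\frac{y^{1/3}}2\int_{\Gamma_k}e^{|y|^{4/3}f(t)-xy^{2/3}t^2}\,dt ,\qquad k=1,2,$$ where - $\Gamma_1=C_1$ if $-\frac\pi2\le\theta<-\frac\pi8$, and $\Gamma_1$ is the segment of $C_1$ with $-2^{1/3}\cos\frac{\pi+2\theta}3\le r\le 2^{-2/3}$ if $|\theta|\le\frac\pi8$; - $\Gamma_2=C_2$ if $\frac\pi8<\theta\le\frac\pi2$, and $\Gamma_2$ is the segment of $C_2$ with $-2^{-2/3}\le r\le 2^{1/3}\cos\frac{\pi-2\theta}3$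 if $|\theta|\le\frac\pi8$. ($P_1$ is considered for $-\frac\pi2\le\theta\le\frac\pi8$ and $P_2$ for $-\frac\pi8\le\theta\le\frac\pi2$.) Let $$a_{n,m,k}(x)=\frac{x^k\,2^{4(2m-n-k)/3}(-1)^m}{k!\,(2m-n-k)!\,(n-m)!},\qquad c_n(x)=\frac1{2^{1/6}}\sqrt{\frac3\pi}\,e^{-x^2/6}\int_{-\infty}^\infty e^{-3\cdot2^{-1/3}u^2+2^{1/3}xu}u^n\,du,$$ $$A_n(x)=\sum_{m=\lfloor (n+1)/2\rfloor}^{n}\ \sum_{k=0}^{2m-n}(-1)^{n+k}a_{n,m,k}(x)\,c_{2m+n-k}(x),\qquad \kappa=2^{1/3}\cos\tfrac{5\pi}{24}\sin\tfrac\pi8+2^{4/3}\cos^4\tfrac{5\pi}{24}.$$ Then all the integrals above converge absolutely, and the following hold. 1. $1.38076<\kappa<1.38077$, and for every $\delta<\kappa$ (in particular $\delta=1.38076$), as $|y|\to\infty$ with $|\arg y|\le\frac\pi8$, $$P(x,y)=P_1(x,y)+P_2(x,y)+\mathcal O\big(e^{-\delta|y|^{4/3}}\big),$$ uniformly in $\arg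 y$ and in $x$ in bounded subsets of $\mathbb C$. 2. $P(x,y)=P_1(x,y)$ whenever $-\frac\pi2\le\arg y<-\frac\pi8$. 3. $P(x,y)=P_2(x,y)$ whenever $\frac\pi8<\arg y\le\frac\pi2$. 4. For $k=1,2$ put $$E_k(x,y)=\frac{\sqrt{\pi/3}}{2^{5/6}y^{1/3}}\exp\Big[3\frac{y^{4/3}}{4^{4/3}}e^{-(-1)^k2i\pi/3}-x\frac{y^{2/3}}{4^{2/3}}e^{-(-1)^ki\pi/3}+\frac{x^2}6\Big].$$ For every $N\ge0$, as $|y|\to\infty$, $$P_k(x,y)=E_k(x,y)\Big[\sum_{n=0}^{N-1}e^{(-1)^k(2n+1)i\pi/6}\frac{A_n(x)}{y^{2n/3}}+\mathcal O\big(|y|^{-2N/3}\big)\Big],$$ uniformly in $x$ in bounded subsets of $\mathbb C$ and in $\arg y\in[-\frac\pi2,\frac\pi8]$ if $k=1$, respectively $\arg y\in[-\frac\pi8,\frac\pi2]$ if $k=2$. 5. Every $A_n$ is a polynomial in $x$ with real coefficients, and for all $n\ge0$ and all $x\in\mathbb C$, $$c_n(x)=\frac{1}{3^n2^{n/3}}\sum_{k=0}^{\lfloor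 n/2\rfloor}\Big(\frac32\Big)^k\frac{n!}{k!\,(n-2k)!}\,x^{n-2k},$$ $$c_0(x)=1,\qquad c_1(x)=\frac{x}{3\cdot2^{1/3}},\qquad c_{n+2}(x)=\frac{x}{3\cdot2^{1/3}}\,c_{n+1}(x)+\frac{n+1}{3\cdot2^{2/3}}\,c_n(x).$$ -/

import Mathlib

noncomputable section

namespace Pearcey

open Complex

/-- The integrand `e^{-t⁴ - x t²} cos (y t)` of the Pearcey integral. -/
def pearceyIntegrand (x y : ℂ) (t : ℝ) : ℂ :=
  exp (-(t : ℂ) ^ 4 - x * (t : ℂ) ^ 2) * cos (y * (t : ℂ))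

/-- The Pearcey integral `P(x,y) = ∫₀^∞ e^{-t⁴ - x t²} cos (y t) dt`. -/
def P (x y : ℂ) : ℂ := ∫ t in Set.Ioi (0 : ℝ), pearceyIntegrand x y t

/-- The phase function `f(t) = e^{4iθ/3} (i t - t⁴)`, with `θ = arg y`. -/
def phase (θ : ℝ) (t : ℂ) : ℂ := exp (4 * I * (θ : ℂ) / 3) * (I * t - t ^ 4)

/-- The function `e^{|y|^{4/3} f(t) - x y^{2/3} t²}`. -/
def contourIntegrand (x y t : ℂ) : ℂ :=
  exp (((‖y‖ ^ (4 / 3 : ℝ) : ℝ) : ℂ) * phase y.arg t - x * y ^ (2 / 3 : ℂ) * t ^ 2)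

/-- The saddle point `t₁ = e^{iπ/6} / 4^{1/3}`. -/
def saddle₁ : ℂ := exp (I * (Real.pi : ℂ) / 6) / (((4 : ℝ) ^ (1 / 3 : ℝ) : ℝ) : ℂ)

/-- The saddle point `t₂ = e^{5iπ/6} / 4^{1/3}`. -/
def saddle₂ : ℂ := exp (5 * I * (Real.pi : ℂ) / 6) / (((4 : ℝ) ^ (1 / 3 : ℝ) : ℝ) : ℂ)

/-- The direction `e^{-i(π+4θ)/6}` of the line `C₁`. -/
def dir₁ (θ : ℝ) : ℂ := exp (-(I * ((Real.pi : ℂ) + 4 * (θ : ℂ)) / 6))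

/-- The direction `e^{i(π-4θ)/6}` of the line `C₂`. -/
def dir₂ (θ : ℝ) : ℂ := exp (I * ((Real.pi : ℂ) - 4 * (θ : ℂ)) / 6)

/-- The arc-length parametrization `r ↦ t₁ + r e^{-i(π+4θ)/6}` of the line `C₁`. -/
def path₁ (θ r : ℝ) : ℂ := saddle₁ + (r : ℂ) * dir₁ θ

/-- The arc-length parametrization `r ↦ t₂ + r e^{i(π-4θ)/6}` of the line `C₂`. -/
def path₂ (θ r : ℝ) : ℂ := saddle₂ + (r : ℂ) * dir₂ θ

/-- `P₁(x,y)`: the factor `y^{1/3} / 2` times the integral of `contourIntegrand x y` over the whole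
line `C₁` if `arg y < -π/8`, and over the segment of `C₁` from its intersection with `C₂`
(`r = -2^{1/3} cos ((π+2θ)/3)`) to its intersection with the line `{s e^{-iθ/3} : s ∈ ℝ}`
(`r = 2^{-2/3}`) otherwise.  It is considered only for `-π/2 ≤ arg y ≤ π/8`. -/
def P₁ (x y : ℂ) : ℂ :=
  y ^ (1 / 3 : ℂ) / 2 *
    (if y.arg < -(Real.pi / 8) then
      ∫ r : ℝ, contourIntegrand x y (path₁ y.arg r) * dir₁ y.arg
    else
      ∫ r in (-((2 : ℝ) ^ (1 / 3 : ℝ) * Real.cos ((Real.pi + 2 * y.arg) / 3)))..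
          ((2 : ℝ) ^ (-(2 / 3) : ℝ)),
        contourIntegrand x y (path₁ y.arg r) * dir₁ y.arg)

/-- `P₂(x,y)`: the factor `y^{1/3} / 2` times the integral of `contourIntegrand x y` over the whole
line `C₂` if `π/8 < arg y`, and over the segment of `C₂` from its intersection with the line
`{s e^{-iθ/3} : s ∈ ℝ}` (`r = -2^{-2/3}`) to its intersection with `C₁`
(`r = 2^{1/3} cos ((π-2θ)/3)`) otherwise.  It is considered only for `-π/8 ≤ arg y ≤ π/2`. -/
def P₂ (x y : ℂ) : ℂ :=
  y ^ (1 / 3 : ℂ) / 2 *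
    (if Real.pi / 8 < y.arg then
      ∫ r : ℝ, contourIntegrand x y (path₂ y.arg r) * dir₂ y.arg
    else
      ∫ r in (-((2 : ℝ) ^ (-(2 / 3) : ℝ)))..
          ((2 : ℝ) ^ (1 / 3 : ℝ) * Real.cos ((Real.pi - 2 * y.arg) / 3)),
        contourIntegrand x y (path₂ y.arg r) * dir₂ y.arg)

/-- The integrand `e^{-3·2^{-1/3} u² + 2^{1/3} x u} uⁿ` of the Gaussian moments. -/
def momentIntegrand (n : ℕ) (x : ℂ) (u : ℝ) : ℂ :=
  exp (-3 * (((2 : ℝ) ^ (-(1 / 3) : ℝ) : ℝ) : ℂ) * (u : ℂ) ^ 2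
      + (((2 : ℝ) ^ (1 / 3 : ℝ) : ℝ) : ℂ) * x * (u : ℂ)) * (u : ℂ) ^ n

/-- The normalized Gaussian moments `c_n(x)`. -/
def c (n : ℕ) (x : ℂ) : ℂ :=
  ((1 / (2 : ℝ) ^ (1 / 6 : ℝ) * Real.sqrt (3 / Real.pi) : ℝ) : ℂ) * exp (-x ^ 2 / 6) *
    ∫ u : ℝ, momentIntegrand n x u

/-- `a_{n,m,k}(x)`, used only for `m ≤ n ≤ 2m` and `k ≤ 2m - n`. -/
def a (n m k : ℕ) (x : ℂ) : ℂ :=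
  x ^ k * (((2 : ℝ) ^ (4 * ((2 * m - n - k : ℕ) : ℝ) / 3) : ℝ) : ℂ) * (-1) ^ m /
    ((k.factorial : ℂ) * ((2 * m - n - k).factorial : ℂ) * ((n - m).factorial : ℂ))

/-- The coefficients `A_n(x)`. -/
def A (n : ℕ) (x : ℂ) : ℂ :=
  ∑ m ∈ Finset.Icc ((n + 1) / 2) n, ∑ k ∈ Finset.range (2 * m - n + 1),
    (-1) ^ (n + k) * a n m k x * c (2 * m + n - k) x

/-- The prefactor of the asymptotic expansion of `P_j(x,y)`, `j = 1, 2`. -/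
def prefactor (j : ℕ) (x y : ℂ) : ℂ :=
  ((Real.sqrt (Real.pi / 3) : ℝ) : ℂ) /
      ((((2 : ℝ) ^ (5 / 6 : ℝ) : ℝ) : ℂ) * y ^ (1 / 3 : ℂ)) *
    exp (3 * (y ^ (4 / 3 : ℂ) / (((4 : ℝ) ^ (4 / 3 : ℝ) : ℝ) : ℂ)) *
          exp (-(-1) ^ j * (2 * I * (Real.pi : ℂ) / 3))
        - x * (y ^ (2 / 3 : ℂ) / (((4 : ℝ) ^ (2 / 3 : ℝ) : ℝ) : ℂ)) *
          exp (-(-1) ^ j * (I * (Real.pi : ℂ) / 3))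
        + x ^ 2 / 6)

/-- The sum of the first `N` terms of the series in the expansion of `P_j(x,y)`, `j = 1, 2`. -/
def partialSum (j N : ℕ) (x y : ℂ) : ℂ :=
  ∑ n ∈ Finset.range N,
    exp ((-1) ^ j * (2 * (n : ℂ) + 1) * (I * (Real.pi : ℂ) / 6)) * (A n x / y ^ (2 * (n : ℂ) / 3))

/-- The exponential rate
`κ = 2^{1/3} cos (5π/24) sin (π/8) + 2^{4/3} cos⁴ (5π/24)`, the value of `-Re f` at the intersection
point `t₁ + 2^{-2/3} e^{-i(π+4θ)/6}` for `θ = π/8`. -/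
def κ : ℝ :=
  (2 : ℝ) ^ (1 / 3 : ℝ) * Real.cos (5 * Real.pi / 24) * Real.sin (Real.pi / 8)
    + (2 : ℝ) ^ (4 / 3 : ℝ) * Real.cos (5 * Real.pi / 24) ^ 4

end Pearcey

end

noncomputable section

namespace Pearcey

open Complex MeasureTheory Filter Topology ComplexConjugate

/-! ### Elementary estimates -/

/-! Write `μ = |y|^{1/3}`. Splitting the cosine, `2P` is the integral over ℝ of the entire function
`exp(-t⁴ - x t² + i y t)`. The substitution `t ↦ y^{1/3} t` turns `P` into `y^{1/3}/2` times the
integral of `contourIntegrand` over the line `L = ℝ e^{-iθ/3}`, with saddle points `t₁`, `t₂`.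

The lines `L`, `C₁`, `C₂` bound a triangle. An entire function has a primitive, so the side on `L`
can be replaced by the two segments of `C₂` and `C₁`. This gives, for every `y ≠ 0`, the exact
identity `P_eq_segInt_add_tailInt`: `P` is the sum of two segment integrals and two tails along `L`.
On the tails the integrand is at most about `exp(-μ⁴ tailHeight(±θ))`, and `tailHeight ≥ κ` for `|θ|
≤ π/8`, with equality at `π/8`; this is the first claim. When `θ < -π/8` the line `L` can be rotated
onto the direction of `C₁` without leaving a sector where `exp(-y^{4/3} t⁴)` decays, so `P = P₁`
(`integral_quarticExp_line_eq`).

For the expansion, `C₁` is parametrized by `u = μ² r`. The exponent is a quartic polynomial, so its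
Taylor expansion at `t₁` is finite: a constant, a Gaussian independent of `y`, and a perturbation `η
p + η² q` with `|η| = μ^{-2}` (`contourIntegrand_path₁`). Between the two vertices the perturbed
Gaussian still has a fixed Gaussian majorant (`norm_baseGauss_mul_exp_pert_le`). Expanding the
exponential in powers of `η` and integrating over ℝ therefore gives the `A_n`, with a uniform error
(`gaussSeg_expansion`).

Along the full line `C₁` the decay degenerates as `θ → -π/8`. Uniformity on `[-π/2, π/8]` is
obtained by always expanding the segment integral: for `θ < -π/8` the identity for `P = P₁` shows
that the other segment and the tails are exponentially smaller than the prefactor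
(`norm_P_sub_segInt₁_le`). The claims on `P₂` follow from those on `P₁` by the reflection `t ↦ -conj
t`. Integration by parts gives the recurrence of the `c_n`, from which the closed form and the
polynomiality of the `A_n` follow. -/

lemma one_add_abs_pow_mul_exp_le (n : ℕ) (C : ℝ) {c : ℝ} (hc : 0 < c) :
    ∃ K : ℝ, 0 ≤ K ∧ ∀ u : ℝ,
      (1 + |u|) ^ n * Real.exp (C * |u|) ≤ K * Real.exp (c * u ^ 2) := by
  -- The power is bounded by `n! exp(1 + |u|)`; completing the square in `(C + 1)|u|` against `c u²`
  -- leaves `(C + 1)² / (4c)`.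
  refine ⟨n.factorial * Real.exp (1 + (C + 1) ^ 2 / (4 * c)), by positivity, fun u => ?_⟩
  have h1 : (1 + |u|) ^ n ≤ n.factorial * Real.exp (1 + |u|) := by
    have := Real.pow_div_factorial_le_exp (1 + |u|) (by positivity) n
    rwa [div_le_iff₀ (by positivity), mul_comm] at this
  have h2 : (C + 1) * |u| ≤ (C + 1) ^ 2 / (4 * c) + c * u ^ 2 := by
    have h : 0 ≤ ((C + 1) - 2 * c * |u|) ^ 2 / (4 * c) := by positivity
    have e : ((C + 1) - 2 * c * |u|) ^ 2 / (4 * c)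
        = (C + 1) ^ 2 / (4 * c) - (C + 1) * |u| + c * |u| ^ 2 := by
      field_simp; ring
    rw [e, sq_abs] at h
    linarith
  calc (1 + |u|) ^ n * Real.exp (C * |u|)
      ≤ n.factorial * Real.exp (1 + |u|) * Real.exp (C * |u|) := by gcongr
    _ = n.factorial * Real.exp (1 + (C + 1) * |u|) := by
        rw [mul_assoc, ← Real.exp_add]; ring_nf
    _ ≤ n.factorial * Real.exp (1 + ((C + 1) ^ 2 / (4 * c) + c * u ^ 2)) := by gcongr
    _ = _ := by rw [← add_assoc, Real.exp_add _ (c * u ^ 2), mul_assoc]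

lemma exists_gaussian_dominates (n : ℕ) (C : ℝ) {c : ℝ} (hc : 0 < c) :
    ∃ K : ℝ, 0 ≤ K ∧ ∀ u : ℝ,
      (1 + |u|) ^ n * Real.exp (-c * u ^ 2 + C * |u|) ≤ K * Real.exp (-(c / 2) * u ^ 2) := by
  obtain ⟨K, hK, h⟩ := one_add_abs_pow_mul_exp_le n C (half_pos hc)
  refine ⟨K, hK, fun u => ?_⟩
  calc (1 + |u|) ^ n * Real.exp (-c * u ^ 2 + C * |u|)
      = (1 + |u|) ^ n * Real.exp (C * |u|) * Real.exp (-c * u ^ 2) := by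
        rw [mul_assoc, ← Real.exp_add]; ring_nf
    _ ≤ K * Real.exp (c / 2 * u ^ 2) * Real.exp (-c * u ^ 2) :=
        mul_le_mul_of_nonneg_right (h u) (Real.exp_nonneg _)
    _ = _ := by rw [mul_assoc, ← Real.exp_add]; ring_nf

/-- Along `t ↦ t z` the remainder of order `N + 1` has derivative `z` times the remainder of order
`N`, so induction and the mean value inequality apply. The growth is measured by `Re z` and not by
`‖z‖`: in the application `z` may be large while a Gaussian times `exp z` stays under a Gaussian. -/
lemma norm_exp_sub_sum_le (N : ℕ) (z : ℂ) :
    ‖exp z - ∑ j ∈ Finset.range N, z ^ j / (j.factorial : ℂ)‖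
      ≤ ‖z‖ ^ N * max 1 (Real.exp z.re) := by
  induction N generalizing z with
  | zero => simp [Complex.norm_exp]
  | succ N ih =>
    have hd : ∀ t : ℝ, HasDerivAt
        (fun t : ℝ => exp (t * z) - ∑ j ∈ Finset.range (N + 1), (t * z) ^ j / (j.factorial : ℂ))
        (z * (exp (t * z) - ∑ j ∈ Finset.range N, (t * z) ^ j / (j.factorial : ℂ))) t := by
      intro t
      have hl : HasDerivAt (fun t : ℝ => (t : ℂ) * z) z t := by
        simpa using (hasDerivAt_id (t : ℂ)).comp_ofReal.mul_const z
      have hs : HasDerivAt (fun t : ℝ => ∑ j ∈ Finset.range N,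
          ((t : ℂ) * z) ^ (j + 1) / ((j + 1).factorial : ℂ))
          (∑ j ∈ Finset.range N, ((t : ℂ) * z) ^ j / (j.factorial : ℂ) * z) t := by
        refine HasDerivAt.fun_sum fun j _ => ?_
        refine ((hl.pow (j + 1)).div_const ((j + 1).factorial : ℂ)).congr_deriv ?_
        have : ((j : ℂ) + 1) ≠ 0 := by exact_mod_cast Nat.succ_ne_zero j
        have h2 : (j.factorial : ℂ) ≠ 0 := by exact_mod_cast j.factorial_ne_zero
        rw [Nat.factorial_succ]
        push_cast
        field_simp
      have := (hl.cexp.sub hs).sub_const 1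
      refine (this.congr_of_eventuallyEq (Eventually.of_forall fun s => ?_)).congr_deriv ?_
      · simp only [Finset.sum_range_succ', Pi.sub_apply]
        simp
        ring
      · rw [← Finset.sum_mul]; ring
    have key := norm_image_sub_le_of_norm_deriv_le_segment_01'
      (C := ‖z‖ ^ (N + 1) * max 1 (Real.exp z.re))
      (fun t _ => (hd t).hasDerivWithinAt) ?_
    · simpa [Finset.sum_range_succ'] using key
    · intro t ht
      rw [norm_mul, pow_succ', mul_assoc]
      gcongr
      refine (ih _).trans ?_
      have h1 : ‖(t : ℂ) * z‖ ≤ ‖z‖ := by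
        rw [norm_mul, Complex.norm_real, Real.norm_of_nonneg ht.1]
        exact mul_le_of_le_one_left (norm_nonneg _) ht.2.le
      refine mul_le_mul (pow_le_pow_left₀ (norm_nonneg _) h1 _) ?_ (by positivity) (by positivity)
      rw [Complex.re_ofReal_mul]
      rcases le_total z.re 0 with h | h
      · refine max_le (le_max_left _ _) ((Real.exp_le_one_iff.2 ?_).trans (le_max_left _ _))
        exact mul_nonpos_of_nonneg_of_nonpos ht.1 h
      · refine max_le (le_max_left _ _) (le_trans ?_ (le_max_right _ _))
        exact Real.exp_le_exp.2 (mul_le_of_le_one_left h ht.2.le)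

lemma exists_quartic_le {c : ℝ} (hc : 0 < c) (D : ℝ) :
    ∃ K : ℝ, ∀ T : ℝ, -c * T ^ 4 + D * (1 + |T|) ^ 3 ≤ K - T ^ 2 := by
  have hcont : Continuous fun T : ℝ => -c * T ^ 4 + 8 * |D| * T ^ 3 + T ^ 2 := by fun_prop
  obtain ⟨M, hM⟩ := (isCompact_Icc (a := (0 : ℝ)) (b := (8 * |D| + 1) / c + 1)).bddAbove_image
    hcont.continuousOn
  have hD := abs_nonneg D
  have hMb : ∀ T : ℝ, 0 ≤ T → -c * T ^ 4 + 8 * |D| * T ^ 3 + T ^ 2 ≤ max M 0 := by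
    intro T hT
    rcases le_total T ((8 * |D| + 1) / c + 1) with h | h
    · exact (hM ⟨T, ⟨hT, h⟩, rfl⟩).trans (le_max_left _ _)
    · refine le_trans ?_ (le_max_right _ _)
      have h0 : 0 ≤ (8 * |D| + 1) / c := by positivity
      have h1 : 1 ≤ T := by linarith
      have h2 : 8 * |D| + 1 ≤ c * T := by
        have : (8 * |D| + 1) / c ≤ T := by linarith
        rw [div_le_iff₀ hc] at this; linarith
      have h3 : T ^ 2 ≤ T ^ 3 := pow_le_pow_right₀ h1 (by norm_num)
      have h4 : (8 * |D| + 1) * T ^ 3 ≤ c * T * T ^ 3 := by gcongr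
      nlinarith
  refine ⟨max M 0 + 8 * |D|, fun T => ?_⟩
  have h := hMb |T| (abs_nonneg T)
  have e4 : |T| ^ 4 = T ^ 4 := by rw [← abs_pow, abs_of_nonneg (by positivity)]
  rw [e4, sq_abs] at h
  have h5 : (1 + |T|) ^ 3 ≤ 8 * |T| ^ 3 + 8 := by
    have := abs_nonneg T
    nlinarith [sq_nonneg (|T| - 1), mul_nonneg this (sq_nonneg (|T| - 1))]
  have h6 : D * (1 + |T|) ^ 3 ≤ |D| * (8 * |T| ^ 3 + 8) :=
    mul_le_mul (le_abs_self D) h5 (by positivity) hD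
  nlinarith

/-! ### The Gaussian moments -/

/-- Products of a Gaussian, an exponential and a polynomial are integrable. -/
lemma integrable_pow_mul_cexp {b : ℝ} (hb : 0 < b) (c : ℂ) (n : ℕ) :
    Integrable fun u : ℝ => exp (-b * (u : ℂ) ^ 2 + c * u) * (u : ℂ) ^ n := by
  obtain ⟨K, hK, h⟩ := exists_gaussian_dominates n ‖c‖ hb
  refine ((integrable_exp_neg_mul_sq (half_pos hb)).const_mul K).mono'
    (by fun_prop : Continuous _).aestronglyMeasurable (Eventually.of_forall fun u => ?_)
  refine le_trans ?_ (h u)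
  rw [norm_mul, Complex.norm_exp, norm_pow, Complex.norm_real, Real.norm_eq_abs, mul_comm]
  gcongr
  · linarith
  · rw [Complex.add_re, ← ofReal_pow, ← ofReal_neg, ← ofReal_mul, ofReal_re]
    gcongr
    refine (re_le_norm _).trans ?_
    simp

lemma integrable_momentIntegrand (n : ℕ) (x : ℂ) : Integrable (momentIntegrand n x) := by
  have := integrable_pow_mul_cexp (b := 3 * (2 : ℝ) ^ (-(1 / 3) : ℝ)) (by positivity)
    ((((2 : ℝ) ^ (1 / 3 : ℝ) : ℝ) : ℂ) * x) n
  convert this using 2 with u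
  simp [momentIntegrand]

/-- The real constant `2^{-2/3}`. -/
def kap : ℝ := (2 : ℝ) ^ (-(2 / 3) : ℝ)

lemma kap_pos : 0 < kap := by unfold kap; positivity

/-- All powers of `2^{1/3}` below are rewritten as monomials in `kap` and simplified with this
single relation. It is also the saddle point equation: `t₁ = kap e^{iπ/6}` satisfies `4 t₁³ = i`. -/
lemma four_kap_cube : 4 * kap ^ 3 = 1 := by
  rw [kap, ← Real.rpow_natCast, ← Real.rpow_mul (by norm_num)]
  norm_num [Real.rpow_neg]

lemma two_rpow_eq_kap (n : ℕ) : (2 : ℝ) ^ ((n : ℝ) / 3) = (2 * kap) ^ n := by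
  have h : (2 : ℝ) * kap = 2 ^ (1 / 3 : ℝ) := by
    rw [kap, ← Real.rpow_one_add' (by norm_num) (by norm_num)]; norm_num
  rw [h, ← Real.rpow_natCast, ← Real.rpow_mul (by norm_num)]
  congr 1; ring

lemma two_rpow_one_third : (2 : ℝ) ^ (1 / 3 : ℝ) = 2 * kap := by
  simpa using two_rpow_eq_kap 1

lemma two_rpow_neg_one_third : (2 : ℝ) ^ (-(1 / 3) : ℝ) = 2 * kap ^ 2 := by
  rw [Real.rpow_neg (by norm_num), two_rpow_one_third]
  have := kap_pos
  field_simp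
  linarith [four_kap_cube]

/-- The unnormalized Gaussian moments. -/
def moment (n : ℕ) (x : ℂ) : ℂ := ∫ u : ℝ, momentIntegrand n x u

lemma momentIntegrand_eq (n : ℕ) (x : ℂ) (u : ℝ) : momentIntegrand n x u =
    exp (-(6 * (kap : ℂ) ^ 2) * (u : ℂ) ^ 2 + 2 * kap * x * u) * (u : ℂ) ^ n := by
  rw [momentIntegrand, two_rpow_neg_one_third, two_rpow_one_third]
  push_cast
  congr 2
  ring

lemma hasDerivAt_momentExponent (x : ℂ) (u : ℝ) :
    HasDerivAt (fun u : ℝ => -(6 * (kap : ℂ) ^ 2) * (u : ℂ) ^ 2 + 2 * kap * x * u)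
      (-(6 * (kap : ℂ) ^ 2) * (2 * u) + 2 * kap * x) u := by
  have hu : HasDerivAt (fun u : ℝ => (u : ℂ)) 1 u := (hasDerivAt_id (u : ℂ)).comp_ofReal
  simpa using ((hu.fun_pow 2).const_mul (-(6 * (kap : ℂ) ^ 2))).fun_add
    (hu.const_mul (2 * kap * x))

lemma hasDerivAt_momentIntegrand_succ (n : ℕ) (x : ℂ) (u : ℝ) :
    HasDerivAt (momentIntegrand (n + 1) x)
      ((n + 1) * momentIntegrand n x u + 2 * kap * x * momentIntegrand (n + 1) x u
        - 12 * kap ^ 2 * momentIntegrand (n + 2) x u) u := by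
  have h2 : HasDerivAt (fun u : ℝ => (u : ℂ) ^ (n + 1)) ((n + 1) * (u : ℂ) ^ n) u := by
    simpa using ((hasDerivAt_id (u : ℂ)).comp_ofReal).fun_pow (n + 1)
  have := (hasDerivAt_momentExponent x u).cexp.mul h2
  refine (this.congr_of_eventuallyEq (Eventually.of_forall fun v => ?_)).congr_deriv ?_
  · rw [momentIntegrand_eq]; rfl
  · simp only [momentIntegrand_eq]; ring

lemma hasDerivAt_momentIntegrand_zero (x : ℂ) (u : ℝ) :
    HasDerivAt (momentIntegrand 0 x)
      (2 * kap * x * momentIntegrand 0 x u - 12 * kap ^ 2 * momentIntegrand 1 x u) u := by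
  refine ((hasDerivAt_momentExponent x u).cexp.congr_of_eventuallyEq
    (Eventually.of_forall fun v => ?_)).congr_deriv ?_
  · rw [momentIntegrand_eq]; simp
  · simp only [momentIntegrand_eq]; ring

/-- Integration by parts: the derivative of the integrand with `u^{n+1}` has integral zero. -/
lemma moment_succ_succ (n : ℕ) (x : ℂ) :
    12 * kap ^ 2 * moment (n + 2) x = (n + 1) * moment n x + 2 * kap * x * moment (n + 1) x := by
  have i0 := (integrable_momentIntegrand n x).const_mul ((n : ℂ) + 1)
  have i1 := (integrable_momentIntegrand (n + 1) x).const_mul (2 * kap * x)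
  have i2 := (integrable_momentIntegrand (n + 2) x).const_mul (12 * (kap : ℂ) ^ 2)
  have h := integral_eq_zero_of_hasDerivAt_of_integrable (hasDerivAt_momentIntegrand_succ n x)
    ((i0.add i1).sub i2) (integrable_momentIntegrand (n + 1) x)
  rw [integral_sub (i0.fun_add i1) i2, integral_add i0 i1, integral_const_mul,
    integral_const_mul, integral_const_mul] at h
  exact (sub_eq_zero.1 h).symm

lemma moment_one (x : ℂ) : 12 * kap ^ 2 * moment 1 x = 2 * kap * x * moment 0 x := by
  have i0 := (integrable_momentIntegrand 0 x).const_mul (2 * kap * x)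
  have i1 := (integrable_momentIntegrand 1 x).const_mul (12 * (kap : ℂ) ^ 2)
  have h := integral_eq_zero_of_hasDerivAt_of_integrable (hasDerivAt_momentIntegrand_zero x)
    (i0.sub i1) (integrable_momentIntegrand 0 x)
  rw [integral_sub i0 i1, integral_const_mul, integral_const_mul] at h
  exact (sub_eq_zero.1 h).symm

/-- The normalization of the moments. -/
def momentNorm : ℝ := 1 / (2 : ℝ) ^ (1 / 6 : ℝ) * Real.sqrt (3 / Real.pi)

lemma momentNorm_pos : 0 < momentNorm := by unfold momentNorm; positivity

lemma c_eq (n : ℕ) (x : ℂ) : c n x = momentNorm * exp (-x ^ 2 / 6) * moment n x := rfl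

/-- The normalization cancels the Gaussian integral `√(π / (6 kap²))`, which makes `c_0 = 1`. -/
lemma momentNorm_sq : momentNorm ^ 2 * Real.pi = 6 * kap ^ 2 := by
  have h : ((2 : ℝ) ^ (1 / 6 : ℝ)) ^ 2 = 2 * kap := by
    rw [← two_rpow_one_third, ← Real.rpow_natCast, ← Real.rpow_mul (by norm_num)]; norm_num
  have := kap_pos
  have h4 := four_kap_cube
  rw [momentNorm, mul_pow, div_pow, h, Real.sq_sqrt (by positivity)]
  field_simp
  linarith

lemma moment_zero (x : ℂ) : momentNorm * moment 0 x = exp (x ^ 2 / 6) := by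
  have hk := kap_pos
  have hkc : (kap : ℂ) ≠ 0 := ofReal_ne_zero.2 hk.ne'
  have h : moment 0 x = ∫ u : ℝ, exp (-(6 * (kap : ℂ) ^ 2) * (u : ℂ) ^ 2 + 2 * kap * x * u + 0) := by
    simp [moment, momentIntegrand_eq]
  have hre : (-(6 * (kap : ℂ) ^ 2)).re < 0 := by
    rw [show -(6 * (kap : ℂ) ^ 2) = ((-(6 * kap ^ 2) : ℝ) : ℂ) by push_cast; ring, ofReal_re]
    nlinarith [pow_pos hk 2]
  rw [h, integral_cexp_quadratic hre]
  have e1 : ((Real.pi : ℂ) / - -(6 * (kap : ℂ) ^ 2)) = ((1 / momentNorm ^ 2 : ℝ) : ℂ) := by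
    have := momentNorm_sq
    have hm := momentNorm_pos
    have h3 : Real.pi / (6 * kap ^ 2) = 1 / momentNorm ^ 2 := by
      field_simp; linarith
    rw [← h3]; push_cast; ring
  have e2 : ((1 / momentNorm ^ 2 : ℝ) : ℂ) ^ (1 / 2 : ℂ) = ((1 / momentNorm : ℝ) : ℂ) := by
    have hm := momentNorm_pos
    rw [show (1 / 2 : ℂ) = ((1 / 2 : ℝ) : ℂ) by push_cast; ring, ← ofReal_cpow (by positivity),
      ← Real.sqrt_eq_rpow, Real.sqrt_div (by norm_num), Real.sqrt_sq hm.le, Real.sqrt_one]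
  rw [e1, e2, ← mul_assoc, ← ofReal_mul, mul_one_div_cancel momentNorm_pos.ne', ofReal_one, one_mul]
  congr 1
  field_simp
  ring

lemma c_zero (x : ℂ) : c 0 x = 1 := by
  rw [c_eq, mul_right_comm, moment_zero, ← Complex.exp_add]
  ring_nf
  simp

lemma c_one (x : ℂ) : c 1 x = x / (3 * (((2 : ℝ) ^ (1 / 3 : ℝ) : ℝ) : ℂ)) := by
  have hkc : (kap : ℂ) ≠ 0 := ofReal_ne_zero.2 kap_pos.ne'
  have h := c_zero x
  rw [two_rpow_one_third, eq_div_iff (by push_cast; simpa using hkc)]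
  rw [c_eq] at h ⊢
  have h1 := moment_one x
  push_cast
  apply mul_left_cancel₀ hkc
  linear_combination (momentNorm * exp (-x ^ 2 / 6) / 2) * h1 + kap * x * h

lemma c_succ_succ (n : ℕ) (x : ℂ) :
    c (n + 2) x = x / (3 * (((2 : ℝ) ^ (1 / 3 : ℝ) : ℝ) : ℂ)) * c (n + 1) x
        + ((n : ℂ) + 1) / (3 * (((2 : ℝ) ^ (2 / 3 : ℝ) : ℝ) : ℂ)) * c n x := by
  have hkc : (kap : ℂ) ≠ 0 := ofReal_ne_zero.2 kap_pos.ne'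
  have h2 := two_rpow_eq_kap 2
  norm_num at h2
  rw [two_rpow_one_third, h2, c_eq, c_eq, c_eq]
  have h1 := moment_succ_succ n x
  push_cast
  field_simp
  linear_combination (momentNorm) * h1

lemma exists_polynomial_c (n : ℕ) : ∃ p : Polynomial ℝ, ∀ x : ℂ, c n x = Polynomial.aeval x p := by
  induction n using Nat.strong_induction_on with
  | _ n ih =>
    match n with
    | 0 => exact ⟨1, fun x => by simp [c_zero]⟩
    | 1 =>
      refine ⟨Polynomial.C (1 / (3 * (2 : ℝ) ^ (1 / 3 : ℝ))) * Polynomial.X, fun x => ?_⟩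
      rw [c_one]
      simp [div_eq_mul_inv, mul_comm]
    | n + 2 =>
      obtain ⟨p, hp⟩ := ih n (by omega)
      obtain ⟨q, hq⟩ := ih (n + 1) (by omega)
      refine ⟨Polynomial.C (1 / (3 * (2 : ℝ) ^ (1 / 3 : ℝ))) * Polynomial.X * q
        + Polynomial.C ((n + 1) / (3 * (2 : ℝ) ^ (2 / 3 : ℝ))) * p, fun x => ?_⟩
      rw [c_succ_succ, hp, hq]
      simp [div_eq_mul_inv, mul_comm]

lemma exists_polynomial_A (n : ℕ) : ∃ p : Polynomial ℝ, ∀ x : ℂ, A n x = Polynomial.aeval x p := by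
  choose p hp using exists_polynomial_c
  refine ⟨∑ m ∈ Finset.Icc ((n + 1) / 2) n, ∑ k ∈ Finset.range (2 * m - n + 1),
    (-1) ^ (n + k) * (Polynomial.X ^ k * Polynomial.C ((2 : ℝ) ^ (4 * ((2 * m - n - k : ℕ) : ℝ) / 3)
      * (-1) ^ m / (k.factorial * (2 * m - n - k).factorial * (n - m).factorial)))
      * p (2 * m + n - k), fun x => ?_⟩
  simp only [A, map_sum, map_mul, map_pow, map_neg, map_one, Polynomial.aeval_X, Polynomial.aeval_C,
    ← hp, a]
  refine Finset.sum_congr rfl fun m _ => Finset.sum_congr rfl fun k _ => ?_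
  simp only [Complex.coe_algebraMap]
  push_cast
  ring

/-- The terms of the closed form of the moments, extended by zero. -/
def hermiteTerm (x : ℂ) (n k : ℕ) : ℂ :=
  if 2 * k ≤ n then (3 / 2) ^ k * x ^ (n - 2 * k) *
    ((n.factorial : ℂ) / ((k.factorial : ℂ) * ((n - 2 * k).factorial : ℂ))) else 0

lemma hermiteTerm_succ_zero (x : ℂ) (n : ℕ) :
    hermiteTerm x (n + 1) 0 = x * hermiteTerm x n 0 := by
  have h (m : ℕ) : (m.factorial : ℂ) ≠ 0 := by exact_mod_cast m.factorial_ne_zero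
  simp [hermiteTerm, h, pow_succ']

/-- Termwise form of the three-term recurrence of the Hermite polynomials; the extension by zero
makes it hold for all `k`. -/
lemma hermiteTerm_succ_succ (x : ℂ) (n k : ℕ) : hermiteTerm x (n + 2) (k + 1) =
    x * hermiteTerm x (n + 1) (k + 1) + 3 * (n + 1) * hermiteTerm x n k := by
  have h (m : ℕ) : (m.factorial : ℂ) ≠ 0 := by exact_mod_cast m.factorial_ne_zero
  have hs (m : ℕ) : (m : ℂ) + 1 ≠ 0 := by exact_mod_cast m.succ_ne_zero
  rcases lt_or_ge n (2 * k) with hlt | hge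
  · rw [hermiteTerm, hermiteTerm, hermiteTerm, if_neg (by omega), if_neg (by omega),
      if_neg (by omega)]
    simp
  obtain ⟨d, rfl⟩ := Nat.exists_eq_add_of_le hge
  -- For `n = 2k` the first term on the right is out of range and vanishes, so this boundary case is
  -- checked apart.
  rcases d with _ | e
  · rw [hermiteTerm, hermiteTerm, hermiteTerm, if_pos (by omega), if_neg (by omega),
      if_pos (by omega), show 2 * k + 0 + 2 - 2 * (k + 1) = 0 by omega,
      show 2 * k + 0 - 2 * k = 0 by omega]
    have h1 := h k
    have h2 := hs k
    simp only [Nat.factorial_succ, Nat.add_zero]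
    push_cast
    field_simp
    ring
  · rw [hermiteTerm, hermiteTerm, hermiteTerm, if_pos (by omega), if_pos (by omega),
      if_pos (by omega), show 2 * k + (e + 1) + 2 - 2 * (k + 1) = e + 1 by omega,
      show 2 * k + (e + 1) + 1 - 2 * (k + 1) = e by omega,
      show 2 * k + (e + 1) - 2 * k = e + 1 by omega,
      Nat.factorial_succ (2 * k + (e + 1) + 1), Nat.factorial_succ (2 * k + (e + 1)),
      Nat.factorial_succ e, Nat.factorial_succ k]
    have h1 := h k
    have h2 := hs k
    have h3 := h e
    have h4 := hs e
    push_cast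
    field_simp
    ring

lemma sum_hermiteTerm (x : ℂ) {n M : ℕ} (hM : n / 2 < M) :
    ∑ k ∈ Finset.range M, hermiteTerm x n k
      = ∑ k ∈ Finset.range (n / 2 + 1), (3 / 2) ^ k * x ^ (n - 2 * k) *
          ((n.factorial : ℂ) / ((k.factorial : ℂ) * ((n - 2 * k).factorial : ℂ))) := by
  rw [← Finset.sum_subset (Finset.range_subset_range.2 (show n / 2 + 1 ≤ M by omega))]
  · refine Finset.sum_congr rfl fun k hk => ?_
    rw [Finset.mem_range] at hk
    rw [hermiteTerm, if_pos (by omega)]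
  · intro k _ hk
    rw [Finset.mem_range] at hk
    rw [hermiteTerm, if_neg (by omega)]

/-- The number `M` of terms is left free because the induction step shifts `k` and needs different
lengths at `n` and `n + 1`. -/
lemma c_eq_sum_hermiteTerm (x : ℂ) (n : ℕ) : ∀ M : ℕ, n / 2 < M →
    c n x = 1 / (3 ^ n * (2 * kap) ^ n) * ∑ k ∈ Finset.range M, hermiteTerm x n k := by
  have hkc : (kap : ℂ) ≠ 0 := ofReal_ne_zero.2 kap_pos.ne'
  induction n using Nat.strong_induction_on with
  | _ n ih =>
    match n with
    | 0 =>
      intro M hM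
      rw [sum_hermiteTerm x hM]
      simp [c_zero]
    | 1 =>
      intro M hM
      rw [sum_hermiteTerm x hM, c_one, two_rpow_one_third]
      simp [div_eq_mul_inv, mul_comm]
    | n + 2 =>
      intro M hM
      obtain ⟨M, rfl⟩ : ∃ m, M = m + 1 := ⟨M - 1, by omega⟩
      have h2 := two_rpow_eq_kap 2
      norm_num at h2
      rw [Finset.sum_range_succ', hermiteTerm_succ_zero, Finset.sum_congr rfl
        fun k _ => hermiteTerm_succ_succ x n k, Finset.sum_add_distrib, ← Finset.mul_sum,
        ← Finset.mul_sum, c_succ_succ, ih n (by omega) M (by omega),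
        ih (n + 1) (by omega) (M + 1) (by omega), Finset.sum_range_succ', two_rpow_one_third, h2]
      push_cast
      field_simp
      ring

lemma c_closed_form (n : ℕ) (x : ℂ) :
    c n x = 1 / (3 ^ n * (((2 : ℝ) ^ ((n : ℝ) / 3) : ℝ) : ℂ)) *
      ∑ k ∈ Finset.range (n / 2 + 1), (3 / 2) ^ k * x ^ (n - 2 * k) *
        ((n.factorial : ℂ) / ((k.factorial : ℂ) * ((n - 2 * k).factorial : ℂ))) := by
  rw [c_eq_sum_hermiteTerm x n (n / 2 + 1) (by omega), sum_hermiteTerm x (by omega),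
    two_rpow_eq_kap]
  push_cast
  rfl

/-! ### Exponentials of quartic polynomials -/

/-- The entire function `e^{-A t⁴ - B t² + C t}`. -/
def quarticExp (A B C t : ℂ) : ℂ := exp (-A * t ^ 4 - B * t ^ 2 + C * t)

lemma differentiable_quarticExp (A B C : ℂ) : Differentiable ℂ (quarticExp A B C) := by
  unfold quarticExp; fun_prop

/-- The only form of Cauchy's theorem in use: every change of contour below is a comparison of
values of a primitive. -/
lemma exists_primitive_quarticExp (A B C : ℂ) :
    ∃ G : ℂ → ℂ, ∀ z, HasDerivAt G (quarticExp A B C z) z := by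
  obtain ⟨G, hG⟩ := (differentiable_quarticExp A B C).isExactOn_univ
  exact ⟨G, fun z => hG z (Set.mem_univ z)⟩

/-- Replacing `A (w + T v)⁴` by `T⁴ A v⁴` costs `O((1 + |T|)³)`, which the quartic decay absorbs.
The constant does not depend on `v` or `w`, as needed when the line is rotated and translated at
once. -/
lemma norm_quarticExp_le (A B C : ℂ) {c : ℝ} (hc : 0 < c) :
    ∃ K : ℝ, ∀ v w : ℂ, ‖v‖ = 1 → ‖w‖ ≤ 1 → c ≤ (A * v ^ 4).re → ∀ T : ℝ,
      ‖quarticExp A B C (w + T * v)‖ ≤ K * Real.exp (-1 * T ^ 2) := by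
  obtain ⟨K, hK⟩ := exists_quartic_le hc (4 * ‖A‖ + ‖B‖ + ‖C‖)
  refine ⟨Real.exp K, fun v w hv hw hA T => ?_⟩
  rw [quarticExp, Complex.norm_exp, ← Real.exp_add]
  refine Real.exp_le_exp.2 (le_trans ?_ ((hK T).trans (by linarith)))
  set z := w + T * v with hz
  have hT := abs_nonneg T
  have hTv : ‖(T : ℂ) * v‖ = |T| := by simp [hv]
  have hzn : ‖z‖ ≤ 1 + |T| := (norm_add_le _ _).trans (by rw [hTv]; linarith)
  have h1 : ‖z ^ 4 - T ^ 4 * v ^ 4‖ ≤ 4 * (1 + |T|) ^ 3 := by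
    have e : z ^ 4 - T ^ 4 * v ^ 4 = w * (z ^ 3 + z ^ 2 * (T * v) + z * (T * v) ^ 2 + (T * v) ^ 3) := by
      rw [hz]; ring
    rw [e, norm_mul]
    have h3 : ‖z ^ 3 + z ^ 2 * (T * v) + z * (T * v) ^ 2 + (T * v) ^ 3‖ ≤ 4 * (1 + |T|) ^ 3 := by
      refine (norm_add_le_of_le (norm_add₃_le) le_rfl).trans ?_
      simp only [norm_mul z, norm_mul (z ^ 2), norm_pow, hTv]
      have a1 : ‖z‖ ^ 3 ≤ (1 + |T|) ^ 3 := by gcongr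
      have a2 : ‖z‖ ^ 2 * |T| ≤ (1 + |T|) ^ 2 * (1 + |T|) := by gcongr; linarith
      have a3 : ‖z‖ * |T| ^ 2 ≤ (1 + |T|) * (1 + |T|) ^ 2 := by gcongr; linarith
      have a4 : |T| ^ 3 ≤ (1 + |T|) ^ 3 := by gcongr; linarith
      nlinarith
    calc _ ≤ 1 * (4 * (1 + |T|) ^ 3) := by gcongr
      _ = _ := one_mul _
  have h2 : ‖z ^ 2‖ ≤ (1 + |T|) ^ 3 := by
    rw [norm_pow]
    calc ‖z‖ ^ 2 ≤ (1 + |T|) ^ 2 := by gcongr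
      _ ≤ (1 + |T|) ^ 3 := pow_le_pow_right₀ (by linarith) (by norm_num)
  have h3 : ‖z‖ ≤ (1 + |T|) ^ 3 := hzn.trans (by
    simpa using pow_le_pow_right₀ (by linarith : 1 ≤ 1 + |T|) (by norm_num : 1 ≤ 3))
  have e : -A * z ^ 4 - B * z ^ 2 + C * z
      = -((T ^ 4 : ℝ) * (A * v ^ 4)) + (-(A * (z ^ 4 - T ^ 4 * v ^ 4)) - B * z ^ 2 + C * z) := by
    push_cast; ring
  rw [e, Complex.add_re, Complex.neg_re, Complex.re_ofReal_mul]
  have h4 : (-(A * (z ^ 4 - T ^ 4 * v ^ 4)) - B * z ^ 2 + C * z).re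
      ≤ (4 * ‖A‖ + ‖B‖ + ‖C‖) * (1 + |T|) ^ 3 := by
    refine (re_le_norm _).trans ?_
    refine (norm_add_le_of_le (norm_sub_le _ _) le_rfl).trans ?_
    rw [norm_neg, norm_mul A, norm_mul B, norm_mul C]
    have b1 := mul_le_mul_of_nonneg_left h1 (norm_nonneg A)
    have b2 := mul_le_mul_of_nonneg_left h2 (norm_nonneg B)
    have b3 := mul_le_mul_of_nonneg_left h3 (norm_nonneg C)
    linarith
  have h5 : T ^ 4 * c ≤ T ^ 4 * (A * v ^ 4).re := by gcongr
  linarith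

lemma integrable_quarticExp_line (A B C : ℂ) {v w : ℂ} (hv : ‖v‖ = 1) (hw : ‖w‖ ≤ 1)
    (hA : 0 < (A * v ^ 4).re) : Integrable fun r : ℝ => quarticExp A B C (w + r * v) := by
  obtain ⟨K, hK⟩ := norm_quarticExp_le A B C hA
  refine ((integrable_exp_neg_mul_sq one_pos).const_mul K).mono' ?_
    (Eventually.of_forall fun r => hK v w hv hw le_rfl r)
  have : Continuous fun r : ℝ => quarticExp A B C (w + r * v) :=
    (differentiable_quarticExp A B C).continuous.comp (by fun_prop)
  exact this.aestronglyMeasurable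

lemma hasDerivAt_comp_line {G : ℂ → ℂ} {g : ℂ → ℂ} (hG : ∀ z, HasDerivAt G (g z) z) (v w : ℂ)
    (r : ℝ) : HasDerivAt (fun r : ℝ => G (w + r * v)) (g (w + r * v) * v) r := by
  have h : HasDerivAt (fun r : ℝ => w + (r : ℂ) * v) v r := by
    simpa using ((hasDerivAt_id (r : ℂ)).comp_ofReal.mul_const v).const_add w
  exact (hG _).comp r h

lemma intervalIntegral_line {G : ℂ → ℂ} {g : ℂ → ℂ} (hG : ∀ z, HasDerivAt G (g z) z)
    (hg : Continuous g) (v w : ℂ) (a b : ℝ) :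
    ∫ r in a..b, g (w + r * v) * v = G (w + b * v) - G (w + a * v) := by
  refine intervalIntegral.integral_eq_sub_of_hasDerivAt
    (fun r _ => hasDerivAt_comp_line hG v w r) ?_
  exact (by fun_prop : Continuous fun r : ℝ => g (w + r * v) * v).intervalIntegrable _ _

/-- The integral of `quarticExp A B C` along a line does not change when the line is rotated within
a sector of decay and translated. -/
lemma integral_quarticExp_line_eq (A B C : ℂ) {u w : ℂ} {α c : ℝ} (hu : ‖u‖ = 1) (hw : ‖w‖ ≤ 1)
    (hc : 0 < c)
    (hA : ∀ s ∈ Set.Icc (0 : ℝ) 1, c ≤ (A * (u * exp (-(I * (α * s)))) ^ 4).re) :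
    ∫ r : ℝ, quarticExp A B C (w + r * (u * exp (-(I * α)))) * (u * exp (-(I * α)))
      = ∫ r : ℝ, quarticExp A B C (r * u) * u := by
  obtain ⟨G, hG⟩ := exists_primitive_quarticExp A B C
  obtain ⟨K, hK⟩ := norm_quarticExp_le A B C hc
  have hcont := (differentiable_quarticExp A B C).continuous
  have hnorm (s : ℝ) : ‖u * exp (-(I * (α * s)))‖ = 1 := by
    rw [norm_mul, hu, show -(I * ((α : ℂ) * s)) = ((-(α * s) : ℝ) : ℂ) * I by push_cast; ring,
      Complex.norm_exp_ofReal_mul_I, mul_one]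
  have hw1 : ∀ s ∈ Set.Icc (0 : ℝ) 1, ‖(s : ℂ) * w‖ ≤ 1 := by
    intro s hs
    rw [norm_mul, Complex.norm_real, Real.norm_of_nonneg hs.1]
    exact mul_le_one₀ hs.2 (norm_nonneg _) hw
  -- The endpoints at parameter `T` of the two lines are joined by `s ↦ s w + T u e^{-iαs}`, whose
  -- speed is at most `1 + |T||α|` and along which the integrand is at most `K e^{-T²}`. Taken at
  -- `T` and at `-T`, this shows that the truncated integrals have the same limit.
  have hbound (T : ℝ) : ‖G (w + T * (u * exp (-(I * α)))) - G (0 + T * u)‖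
      ≤ K * Real.exp (-1 * T ^ 2) * (1 + |T| * |α|) := by
    have hd (s : ℝ) : HasDerivAt (fun s : ℝ => (s : ℂ) * w + T * (u * exp (-(I * (α * s)))))
        (w + T * (u * (exp (-(I * (α * s))) * (-(I * α))))) s := by
      have h0 : HasDerivAt (fun s : ℝ => (s : ℂ)) 1 s := (hasDerivAt_id (s : ℂ)).comp_ofReal
      have h1 : HasDerivAt (fun s : ℝ => -(I * ((α : ℂ) * s))) (-(I * α)) s := by
        simpa using ((h0.const_mul (α : ℂ)).const_mul I).fun_neg
      simpa using (h0.mul_const w).fun_add ((h1.cexp.const_mul u).const_mul (T : ℂ))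
    have := norm_image_sub_le_of_norm_deriv_le_segment_01'
      (f := fun s : ℝ => G ((s : ℂ) * w + T * (u * exp (-(I * (α * s))))))
      (C := K * Real.exp (-1 * T ^ 2) * (1 + |T| * |α|))
      (fun s _ => ((hG _).comp s (hd s)).hasDerivWithinAt) ?_
    · simpa using this
    · intro s hs
      have hs' : s ∈ Set.Icc (0 : ℝ) 1 := ⟨hs.1, hs.2.le⟩
      rw [norm_mul]
      have h1 := hK _ _ (hnorm s) (hw1 s hs') (hA s hs') T
      refine mul_le_mul h1 ?_ (norm_nonneg _) ((norm_nonneg _).trans h1)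
      refine norm_add_le_of_le hw ?_
      rw [← mul_assoc u, norm_mul, norm_mul, hnorm]
      simp
  have hlim : ∀ l : Filter ℝ, Tendsto (fun T : ℝ => Real.exp (-1 * T ^ 2) * (1 + |T| * |α|)) l (𝓝 0) →
      Tendsto (fun T : ℝ => G (w + T * (u * exp (-(I * α)))) - G (0 + T * u)) l (𝓝 0) := by
    intro l hl
    refine squeeze_zero_norm (fun T => hbound T) ?_
    simpa [mul_assoc] using hl.const_mul K
  have hvanish : Tendsto (fun T : ℝ => Real.exp (-1 * T ^ 2) * (1 + |T| * |α|)) (cocompact ℝ) (𝓝 0) := by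
    have h0 := tendsto_rpow_abs_mul_exp_neg_mul_sq_cocompact (a := 1) one_pos 0
    have h1 := tendsto_rpow_abs_mul_exp_neg_mul_sq_cocompact (a := 1) one_pos 1
    have := h0.add (h1.const_mul |α|)
    simp only [mul_zero, add_zero] at this
    refine this.congr fun T => ?_
    simp only [Real.rpow_zero, Real.rpow_one]
    ring
  have hA1 := hA 1 ⟨zero_le_one, le_rfl⟩
  have hA0 := hA 0 ⟨le_rfl, zero_le_one⟩
  simp only [ofReal_zero, ofReal_one, mul_zero, mul_one, neg_zero, exp_zero] at hA0 hA1
  have hn1 := hnorm 1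
  simp only [ofReal_one, mul_one] at hn1
  have i1 := (integrable_quarticExp_line A B C hn1 hw (hc.trans_le hA1)).mul_const
    (u * exp (-(I * α)))
  have i0 := (integrable_quarticExp_line A B C hu (w := 0) (by simp) (hc.trans_le hA0)).mul_const u
  have t1 := intervalIntegral_tendsto_integral i1 tendsto_neg_atTop_atBot tendsto_id
  have t0 := intervalIntegral_tendsto_integral i0 tendsto_neg_atTop_atBot tendsto_id
  have hdiff := t1.sub t0
  simp only [intervalIntegral_line hG hcont, id] at hdiff
  have hdiff' := (hlim _ (hvanish.mono_left atTop_le_cocompact)).sub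
    ((hlim _ (hvanish.mono_left atBot_le_cocompact)).comp tendsto_neg_atTop_atBot)
  have := tendsto_nhds_unique hdiff ((hdiff'.congr fun T => by
    simp only [Function.comp]; ring))
  simp only [zero_add, sub_zero, sub_eq_zero] at this
  exact this

/-! ### Polar coordinates -/

/-- The modulus of `y^{1/3}`. -/
def cbrtNorm (y : ℂ) : ℝ := ‖y‖ ^ (1 / 3 : ℝ)

/-- The number `e^{iθ/3}`. -/
def cbrtDir (θ : ℝ) : ℂ := exp (((θ / 3 : ℝ) : ℂ) * I)

/-- The number `e^{iπ/6}`. -/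
def zeta : ℂ := exp (((Real.pi / 6 : ℝ) : ℂ) * I)

lemma zeta_ne_zero : zeta ≠ 0 := exp_ne_zero _

lemma cbrtDir_ne_zero (θ : ℝ) : cbrtDir θ ≠ 0 := exp_ne_zero _

lemma norm_zeta : ‖zeta‖ = 1 := norm_exp_ofReal_mul_I _

lemma norm_cbrtDir (θ : ℝ) : ‖cbrtDir θ‖ = 1 := norm_exp_ofReal_mul_I _

lemma zeta_cube : zeta ^ 3 = I := by
  rw [zeta, ← Complex.exp_nat_mul]
  refine Eq.trans ?_ Complex.exp_pi_div_two_mul_I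
  congr 1; push_cast; ring

lemma cbrtNorm_pos {y : ℂ} (hy : y ≠ 0) : 0 < cbrtNorm y :=
  Real.rpow_pos_of_pos (norm_pos_iff.2 hy) _

lemma norm_rpow_eq (y : ℂ) (n : ℕ) : ‖y‖ ^ ((n : ℝ) / 3) = cbrtNorm y ^ n := by
  rw [cbrtNorm, ← Real.rpow_natCast, ← Real.rpow_mul (norm_nonneg _)]
  congr 1; ring

lemma cpow_eq {y : ℂ} (hy : y ≠ 0) (n : ℕ) :
    y ^ ((n : ℂ) / 3) = (cbrtNorm y * cbrtDir y.arg) ^ n := by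
  rw [mul_pow, ← ofReal_pow, ← norm_rpow_eq, cbrtDir, ← Complex.exp_nat_mul,
    cpow_def_of_ne_zero hy, Complex.log, Real.rpow_def_of_pos (norm_pos_iff.2 hy), ofReal_exp,
    ← Complex.exp_add]
  congr 1; push_cast; ring

lemma cpow_one_third {y : ℂ} (hy : y ≠ 0) : y ^ (1 / 3 : ℂ) = cbrtNorm y * cbrtDir y.arg := by
  simpa using cpow_eq hy 1

lemma cpow_two_thirds {y : ℂ} (hy : y ≠ 0) :
    y ^ (2 / 3 : ℂ) = (cbrtNorm y * cbrtDir y.arg) ^ 2 := by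
  simpa using cpow_eq hy 2

lemma cpow_four_thirds {y : ℂ} (hy : y ≠ 0) :
    y ^ (4 / 3 : ℂ) = (cbrtNorm y * cbrtDir y.arg) ^ 4 := by
  simpa using cpow_eq hy 4

lemma eq_cbrt_cube {y : ℂ} (hy : y ≠ 0) : y = (cbrtNorm y * cbrtDir y.arg) ^ 3 := by
  simpa using cpow_eq hy 3

lemma four_rpow_one_third_inv : ((4 : ℝ) ^ (1 / 3 : ℝ))⁻¹ = kap := by
  rw [kap, show (4 : ℝ) = 2 ^ (2 : ℝ) by norm_num, ← Real.rpow_mul (by norm_num),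
    ← Real.rpow_neg (by norm_num)]
  norm_num

lemma saddle₁_eq : saddle₁ = kap * zeta := by
  rw [saddle₁, div_eq_mul_inv, ← ofReal_inv, four_rpow_one_third_inv, zeta, mul_comm]
  congr 2; push_cast; ring

lemma saddle₂_eq : saddle₂ = kap * zeta ^ 5 := by
  rw [saddle₂, div_eq_mul_inv, ← ofReal_inv, four_rpow_one_third_inv, zeta, mul_comm,
    ← Complex.exp_nat_mul]
  congr 2; push_cast; ring

lemma dir₁_eq (θ : ℝ) : dir₁ θ = zeta⁻¹ * (cbrtDir θ)⁻¹ ^ 2 := by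
  rw [dir₁, zeta, cbrtDir, ← Complex.exp_neg, ← Complex.exp_neg, ← Complex.exp_nat_mul,
    ← Complex.exp_add]
  congr 1; push_cast; ring

lemma dir₂_eq (θ : ℝ) : dir₂ θ = zeta * (cbrtDir θ)⁻¹ ^ 2 := by
  rw [dir₂, zeta, cbrtDir, ← Complex.exp_neg, ← Complex.exp_nat_mul, ← Complex.exp_add]
  congr 1; push_cast; ring

lemma phase_eq (θ : ℝ) (t : ℂ) : phase θ t = cbrtDir θ ^ 4 * (I * t - t ^ 4) := by
  rw [phase, cbrtDir, ← Complex.exp_nat_mul]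
  congr 2; push_cast; ring

lemma contourIntegrand_eq (x : ℂ) {y : ℂ} (hy : y ≠ 0) (t : ℂ) :
    contourIntegrand x y t = quarticExp ((cbrtNorm y * cbrtDir y.arg) ^ 4)
      (x * (cbrtNorm y * cbrtDir y.arg) ^ 2) ((cbrtNorm y * cbrtDir y.arg) ^ 4 * I) t := by
  have h := norm_rpow_eq y 4
  norm_num at h
  rw [contourIntegrand, quarticExp, cpow_two_thirds hy, phase_eq, h]
  congr 1; push_cast; ring

lemma zeta_pow_six : zeta ^ 6 = -1 := by
  rw [show zeta ^ 6 = (zeta ^ 3) ^ 2 by ring, zeta_cube, I_sq]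

/-- Turns the cosines in the endpoints of the segments into Laurent polynomials in `zeta` and
`cbrtDir θ`, so that the intersection points can be checked by algebra. -/
lemma two_cos_eq (θ : ℝ) (n : ℕ) : 2 * ((Real.cos (n * (Real.pi + 2 * θ) / 6) : ℝ) : ℂ)
    = (zeta * cbrtDir θ) ^ n + ((zeta * cbrtDir θ)⁻¹) ^ n := by
  rw [zeta, cbrtDir, ← Complex.exp_add, ← Complex.exp_neg, ← Complex.exp_nat_mul,
    ← Complex.exp_nat_mul, ofReal_cos, Complex.two_cos]
  congr 2 <;> push_cast <;> ring

lemma cbrtDir_neg (θ : ℝ) : cbrtDir (-θ) = (cbrtDir θ)⁻¹ := by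
  rw [cbrtDir, cbrtDir, ← Complex.exp_neg]
  congr 1; push_cast; ring

/-- The parameter of the intersection of `C₁` and the line `{s e^{-iθ/3} : s ∈ ℝ}` on the latter. -/
def tailStart (θ : ℝ) : ℝ := 2 * kap * Real.cos ((Real.pi + 2 * θ) / 6)

lemma path₁_right (θ : ℝ) :
    path₁ θ ((2 : ℝ) ^ (-(2 / 3) : ℝ)) = 0 + tailStart θ * (cbrtDir θ)⁻¹ := by
  have h := two_cos_eq θ 1
  have hz := zeta_ne_zero
  have hE := cbrtDir_ne_zero θ
  simp only [Nat.cast_one, one_mul, pow_one] at h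
  rw [path₁, saddle₁_eq, dir₁_eq, tailStart, ← kap, ofReal_mul, ofReal_mul, ofReal_ofNat,
    show (2 : ℂ) * kap * ((Real.cos ((Real.pi + 2 * θ) / 6) : ℝ) : ℂ)
      = kap * (2 * ((Real.cos ((Real.pi + 2 * θ) / 6) : ℝ) : ℂ)) by ring, h]
  field_simp
  ring

lemma path₁_left (θ : ℝ) :
    path₁ θ (-((2 : ℝ) ^ (1 / 3 : ℝ) * Real.cos ((Real.pi + 2 * θ) / 3)))
      = kap * zeta ^ 3 * (cbrtDir θ)⁻¹ ^ 4 := by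
  have h := two_cos_eq θ 2
  have hz := zeta_ne_zero
  have hE := cbrtDir_ne_zero θ
  have h6 := zeta_pow_six
  rw [show ((2 : ℕ) : ℝ) * (Real.pi + 2 * θ) / 6 = (Real.pi + 2 * θ) / 3 by push_cast; ring] at h
  rw [path₁, saddle₁_eq, dir₁_eq, two_rpow_one_third, ofReal_neg, ofReal_mul, ofReal_mul,
    ofReal_ofNat, show (2 : ℂ) * kap * ((Real.cos ((Real.pi + 2 * θ) / 3) : ℝ) : ℂ)
      = kap * (2 * ((Real.cos ((Real.pi + 2 * θ) / 3) : ℝ) : ℂ)) by ring, h]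
  field_simp
  linear_combination (-kap : ℂ) * h6

lemma path₂_left (θ : ℝ) :
    path₂ θ (-((2 : ℝ) ^ (-(2 / 3) : ℝ))) = 0 + ((-tailStart (-θ) : ℝ) : ℂ) * (cbrtDir θ)⁻¹ := by
  have h := two_cos_eq (-θ) 1
  have hz := zeta_ne_zero
  have hE := cbrtDir_ne_zero θ
  have h6 := zeta_pow_six
  simp only [Nat.cast_one, one_mul, pow_one] at h
  rw [path₂, saddle₂_eq, dir₂_eq, tailStart, ← kap, ofReal_neg, ofReal_neg, ofReal_mul, ofReal_mul,
    ofReal_ofNat, show (2 : ℂ) * kap * ((Real.cos ((Real.pi + 2 * -θ) / 6) : ℝ) : ℂ)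
      = kap * (2 * ((Real.cos ((Real.pi + 2 * -θ) / 6) : ℝ) : ℂ)) by ring, h, cbrtDir_neg]
  field_simp
  linear_combination (kap * cbrtDir θ ^ 2) * h6

/-- The right-hand side is that of `path₁_left`: this common vertex makes the two segments join end
to end. -/
lemma path₂_right (θ : ℝ) :
    path₂ θ ((2 : ℝ) ^ (1 / 3 : ℝ) * Real.cos ((Real.pi - 2 * θ) / 3))
      = kap * zeta ^ 3 * (cbrtDir θ)⁻¹ ^ 4 := by
  have h := two_cos_eq (-θ) 2
  have hz := zeta_ne_zero
  have hE := cbrtDir_ne_zero θ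
  have h6 := zeta_pow_six
  rw [show ((2 : ℕ) : ℝ) * (Real.pi + 2 * -θ) / 6 = (Real.pi - 2 * θ) / 3 by push_cast; ring] at h
  rw [path₂, saddle₂_eq, dir₂_eq, two_rpow_one_third, ofReal_mul, ofReal_mul,
    ofReal_ofNat, show (2 : ℂ) * kap * ((Real.cos ((Real.pi - 2 * θ) / 3) : ℝ) : ℂ)
      = kap * (2 * ((Real.cos ((Real.pi - 2 * θ) / 3) : ℝ) : ℂ)) by ring, h, cbrtDir_neg]
  field_simp
  linear_combination (kap * cbrtDir θ ^ 4) * h6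

/-! ### The Pearcey integral as an integral along a line -/

lemma pearceyIntegrand_eq (x y : ℂ) (t : ℝ) : pearceyIntegrand x y t =
    (quarticExp 1 x (I * y) t + quarticExp 1 x (I * y) ((-t : ℝ) : ℂ)) / 2 := by
  rw [pearceyIntegrand, quarticExp, quarticExp, Complex.cos, mul_div_assoc', mul_add,
    ← Complex.exp_add, ← Complex.exp_add]
  congr 3 <;> push_cast <;> ring

lemma integrable_quarticExp_one (x y : ℂ) :
    Integrable fun t : ℝ => quarticExp 1 x (I * y) t := by
  simpa using integrable_quarticExp_line 1 x (I * y) (v := 1) (w := 0) (by simp) (by simp) (by simp)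

lemma integrableOn_pearceyIntegrand (x y : ℂ) :
    IntegrableOn (pearceyIntegrand x y) (Set.Ioi 0) := by
  have h := integrable_quarticExp_one x y
  refine ((h.add h.comp_neg).div_const 2).integrableOn.congr_fun (fun t _ => ?_) measurableSet_Ioi
  rw [pearceyIntegrand_eq]; rfl

lemma two_mul_P_eq_integral (x y : ℂ) :
    2 * P x y = ∫ t : ℝ, quarticExp 1 x (I * y) t := by
  have h := integrable_quarticExp_one x y
  simp only [P, pearceyIntegrand_eq]
  rw [integral_div, integral_add h.integrableOn h.comp_neg.integrableOn,
    integral_comp_neg_Ioi 0 (fun t : ℝ => quarticExp 1 x (I * y) t), neg_zero, add_comm,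
    intervalIntegral.integral_Iic_add_Ioi h.integrableOn h.integrableOn]
  ring

/-- For `t = s e^{-iθ/3}` the number `y^{1/3} t = |y|^{1/3} s` is real, so the original integrand
reappears. -/
lemma contourIntegrand_ray (x : ℂ) {y : ℂ} (hy : y ≠ 0) (s : ℝ) :
    contourIntegrand x y (s * (cbrtDir y.arg)⁻¹)
      = quarticExp 1 x (I * y) ((cbrtNorm y * s : ℝ) : ℂ) := by
  have hE := cbrtDir_ne_zero y.arg
  rw [contourIntegrand_eq x hy, quarticExp, quarticExp]
  have h3 := eq_cbrt_cube hy
  congr 1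
  generalize cbrtDir y.arg = e at *
  generalize cbrtNorm y = m at *
  subst h3
  push_cast
  field_simp

lemma integrable_contourIntegrand_ray (x : ℂ) {y : ℂ} (hy : y ≠ 0) :
    Integrable fun s : ℝ => contourIntegrand x y (s * (cbrtDir y.arg)⁻¹) := by
  simp only [contourIntegrand_ray x hy]
  exact (integrable_quarticExp_one x y).comp_mul_left' (cbrtNorm_pos hy).ne'

lemma P_eq_integral_ray (x : ℂ) {y : ℂ} (hy : y ≠ 0) :
    P x y = y ^ (1 / 3 : ℂ) / 2 *
      ∫ s : ℝ, contourIntegrand x y (s * (cbrtDir y.arg)⁻¹) * (cbrtDir y.arg)⁻¹ := by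
  have hE := cbrtDir_ne_zero y.arg
  have hm := cbrtNorm_pos hy
  have hmc : (cbrtNorm y : ℂ) ≠ 0 := ofReal_ne_zero.2 hm.ne'
  simp only [integral_mul_const, contourIntegrand_ray x hy]
  rw [Measure.integral_comp_mul_left (fun t : ℝ => quarticExp 1 x (I * y) t),
    ← two_mul_P_eq_integral, cpow_one_third hy, abs_of_pos (inv_pos.2 hm), Complex.real_smul,
    ofReal_inv]
  field_simp

lemma continuous_contourIntegrand (x y : ℂ) : Continuous (contourIntegrand x y) := by
  unfold contourIntegrand phase; fun_prop

/-- The integral over the segment of `C₁` between its intersections with `C₂` and with the line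
`{s e^{-iθ/3} : s ∈ ℝ}`. -/
def segInt₁ (x y : ℂ) : ℂ :=
  ∫ r in (-((2 : ℝ) ^ (1 / 3 : ℝ) * Real.cos ((Real.pi + 2 * y.arg) / 3)))..
      ((2 : ℝ) ^ (-(2 / 3) : ℝ)), contourIntegrand x y (path₁ y.arg r) * dir₁ y.arg

/-- The integral over the segment of `C₂` between its intersections with the line
`{s e^{-iθ/3} : s ∈ ℝ}` and with `C₁`. -/
def segInt₂ (x y : ℂ) : ℂ :=
  ∫ r in (-((2 : ℝ) ^ (-(2 / 3) : ℝ)))..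
      ((2 : ℝ) ^ (1 / 3 : ℝ) * Real.cos ((Real.pi - 2 * y.arg) / 3)),
    contourIntegrand x y (path₂ y.arg r) * dir₂ y.arg

/-- The integral of the Pearcey integrand beyond the segments. -/
def tailInt (x y : ℂ) : ℂ :=
  ∫ s in Set.Ioi (tailStart y.arg), contourIntegrand x y (s * (cbrtDir y.arg)⁻¹)

/-- The integral of the Pearcey integrand before the segments. -/
def tailInt' (x y : ℂ) : ℂ :=
  ∫ s in Set.Iic (-tailStart (-y.arg)), contourIntegrand x y (s * (cbrtDir y.arg)⁻¹)

/-- With a primitive, the side of the triangle on `L` equals the sum of the other two; the rest of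
`L` is the two tails. No condition on `arg y` enters, so the identity also serves where `P₁` is an
integral over a full line. -/
lemma P_eq_segInt_add_tailInt (x : ℂ) {y : ℂ} (hy : y ≠ 0) :
    P x y = y ^ (1 / 3 : ℂ) / 2 * (segInt₁ x y + segInt₂ x y)
      + cbrtNorm y / 2 * (tailInt x y + tailInt' x y) := by
  have hE := cbrtDir_ne_zero y.arg
  have hi := integrable_contourIntegrand_ray x hy
  obtain ⟨G, hG⟩ := exists_primitive_quarticExp ((cbrtNorm y * cbrtDir y.arg) ^ 4)
      (x * (cbrtNorm y * cbrtDir y.arg) ^ 2) ((cbrtNorm y * cbrtDir y.arg) ^ 4 * I)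
  have hG' : ∀ z, HasDerivAt G (contourIntegrand x y z) z := fun z => by
    rw [contourIntegrand_eq x hy]; exact hG z
  have hc := continuous_contourIntegrand x y
  have hline := intervalIntegral_line hG' hc (cbrtDir y.arg)⁻¹ 0 (-tailStart (-y.arg))
    (tailStart y.arg)
  have h1 : segInt₁ x y = _ := intervalIntegral_line hG' hc (dir₁ y.arg) saddle₁ _ _
  have h2 : segInt₂ x y = _ := intervalIntegral_line hG' hc (dir₂ y.arg) saddle₂ _ _
  have p1 := path₁_left y.arg
  have p2 := path₁_right y.arg
  have p3 := path₂_left y.arg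
  have p4 := path₂_right y.arg
  simp only [path₁, path₂] at p1 p2 p3 p4
  rw [p1, p2] at h1
  rw [p3, p4] at h2
  rw [h1, h2, sub_add_sub_cancel, ← hline, P_eq_integral_ray x hy, integral_mul_const,
    intervalIntegral.integral_mul_const, cpow_one_third hy]
  simp only [zero_add]
  have hsum : ∫ s : ℝ, contourIntegrand x y (s * (cbrtDir y.arg)⁻¹)
      = tailInt' x y + (∫ s in (-tailStart (-y.arg))..(tailStart y.arg),
          contourIntegrand x y (s * (cbrtDir y.arg)⁻¹)) + tailInt x y := by
    rw [tailInt, tailInt', ← intervalIntegral.integral_Iic_sub_Iic hi.integrableOn hi.integrableOn,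
      add_sub_cancel, intervalIntegral.integral_Iic_add_Ioi hi.integrableOn hi.integrableOn]
  rw [hsum]
  field_simp
  ring

/-- Turning `L` by the fraction `s` of the angle `(π + 2θ)/6` turns the quartic term by `s · 2(π +
2θ)/3`; the cosine is smallest at `s = 1`. That last angle is below `π/2` exactly when `θ < -π/8`,
which is the origin of this threshold. -/
lemma re_sector_pos (θ : ℝ) (h1 : -(Real.pi / 2) ≤ θ) (h2 : θ < -(Real.pi / 8)) {μ : ℝ} {s : ℝ}
    (hs : s ∈ Set.Icc (0 : ℝ) 1) :
    μ ^ 4 * Real.cos (2 * (Real.pi + 2 * θ) / 3) ≤ ((μ * cbrtDir θ) ^ 4 *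
      ((cbrtDir θ)⁻¹ * exp (-(I * (((Real.pi + 2 * θ) / 6 : ℝ) * s)))) ^ 4).re := by
  have hE := cbrtDir_ne_zero θ
  have e : ((μ * cbrtDir θ) ^ 4 *
      ((cbrtDir θ)⁻¹ * exp (-(I * (((Real.pi + 2 * θ) / 6 : ℝ) * s)))) ^ 4)
      = ((μ ^ 4 : ℝ) : ℂ) * exp (((-(2 * (Real.pi + 2 * θ) / 3 * s) : ℝ) : ℂ) * I) := by
    rw [mul_pow (cbrtDir θ)⁻¹, ← Complex.exp_nat_mul]
    field_simp
    push_cast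
    congr 2; ring
  rw [e, Complex.re_ofReal_mul, Complex.exp_ofReal_mul_I_re, Real.cos_neg]
  refine mul_le_mul_of_nonneg_left ?_ (by positivity)
  have h0 : 0 ≤ 2 * (Real.pi + 2 * θ) / 3 := by linarith
  refine Real.cos_le_cos_of_nonneg_of_le_pi (mul_nonneg h0 hs.1) ?_ (mul_le_of_le_one_right h0 hs.2)
  linarith [Real.pi_pos]

lemma dir₁_eq_rotate (θ : ℝ) :
    dir₁ θ = (cbrtDir θ)⁻¹ * exp (-(I * ((Real.pi + 2 * θ) / 6 : ℝ))) := by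
  rw [dir₁, cbrtDir, ← Complex.exp_neg, ← Complex.exp_add]
  congr 1; push_cast; ring

lemma norm_dir₁ (θ : ℝ) : ‖dir₁ θ‖ = 1 := by
  rw [dir₁_eq, norm_mul, norm_pow, norm_inv, norm_inv, norm_zeta, norm_cbrtDir]; norm_num

lemma kap_lt_one : kap < 1 := by
  unfold kap
  exact Real.rpow_lt_one_of_one_lt_of_neg (by norm_num) (by norm_num)

lemma norm_saddle₁_le : ‖saddle₁‖ ≤ 1 := by
  rw [saddle₁_eq, norm_mul, norm_zeta, Complex.norm_real, Real.norm_of_nonneg kap_pos.le, mul_one]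
  exact kap_lt_one.le

lemma cos_sector_pos {θ : ℝ} (h1 : -(Real.pi / 2) ≤ θ) (h2 : θ < -(Real.pi / 8)) :
    0 < Real.cos (2 * (Real.pi + 2 * θ) / 3) :=
  Real.cos_pos_of_mem_Ioo ⟨by linarith [Real.pi_pos], by linarith⟩

lemma arg_ne_imp {y : ℂ} (h : y.arg < -(Real.pi / 8)) : y ≠ 0 := by
  rintro rfl
  rw [arg_zero] at h
  linarith [Real.pi_pos]

lemma integrable_line₁ (x y : ℂ) (h1 : -(Real.pi / 2) ≤ y.arg) (h2 : y.arg < -(Real.pi / 8)) :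
    Integrable fun r : ℝ => contourIntegrand x y (path₁ y.arg r) * dir₁ y.arg := by
  have hy := arg_ne_imp h2
  have h := re_sector_pos y.arg h1 h2 (μ := cbrtNorm y) (s := 1) ⟨zero_le_one, le_rfl⟩
  rw [ofReal_one, mul_one, ← dir₁_eq_rotate] at h
  simp only [contourIntegrand_eq x hy, path₁]
  refine (integrable_quarticExp_line _ _ _ (norm_dir₁ _) norm_saddle₁_le ?_).mul_const _
  exact lt_of_lt_of_le (mul_pos (pow_pos (cbrtNorm_pos hy) 4) (cos_sector_pos h1 h2)) h

lemma P_eq_P₁ (x y : ℂ) (h1 : -(Real.pi / 2) ≤ y.arg) (h2 : y.arg < -(Real.pi / 8)) :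
    P x y = P₁ x y := by
  have hy := arg_ne_imp h2
  rw [P₁, if_pos h2, P_eq_integral_ray x hy]
  have hu : ‖(cbrtDir y.arg)⁻¹‖ = 1 := by rw [norm_inv, norm_cbrtDir, inv_one]
  have := integral_quarticExp_line_eq ((cbrtNorm y * cbrtDir y.arg) ^ 4)
    (x * (cbrtNorm y * cbrtDir y.arg) ^ 2) ((cbrtNorm y * cbrtDir y.arg) ^ 4 * I) hu
    norm_saddle₁_le (mul_pos (pow_pos (cbrtNorm_pos hy) 4) (cos_sector_pos h1 h2))
    (fun s hs => re_sector_pos y.arg h1 h2 hs)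
  rw [← dir₁_eq_rotate] at this
  simp only [contourIntegrand_eq x hy, path₁]
  rw [this]

/-! ### The tails -/

lemma kap_gt : 0.6299605 < kap := by
  have h := four_kap_cube
  have h0 := kap_pos
  by_contra! hle
  have : kap ^ 3 ≤ 0.6299605 ^ 3 := by gcongr
  norm_num at this
  linarith

lemma kap_lt : kap < 0.629961 := by
  have h := four_kap_cube
  by_contra! hle
  have : (0.629961 : ℝ) ^ 3 ≤ kap ^ 3 := by gcongr
  norm_num at this
  linarith

/-- The value of `-Re f` where `C₁` meets the line `{s e^{-iθ/3} : s ∈ ℝ}`. -/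
def tailHeight (θ : ℝ) : ℝ :=
  2 * kap * (3 * Real.cos ((Real.pi + 2 * θ) / 6) ^ 2 - 2 * Real.cos ((Real.pi + 2 * θ) / 6) ^ 4)

lemma sin_eq_cos_third (θ : ℝ) : Real.sin θ =
    3 * Real.cos ((Real.pi + 2 * θ) / 6) - 4 * Real.cos ((Real.pi + 2 * θ) / 6) ^ 3 := by
  have h := Real.cos_three_mul ((Real.pi + 2 * θ) / 6)
  rw [show 3 * ((Real.pi + 2 * θ) / 6) = θ + Real.pi / 2 by ring, Real.cos_add_pi_div_two] at h
  linarith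

lemma half_le_cos_third {θ : ℝ} (h1 : -(Real.pi / 2) ≤ θ) (h2 : θ ≤ Real.pi / 2) :
    1 / 2 ≤ Real.cos ((Real.pi + 2 * θ) / 6) := by
  rw [← Real.cos_pi_div_three]
  have := Real.pi_pos
  exact Real.cos_le_cos_of_nonneg_of_le_pi (by linarith) (by linarith) (by linarith)

/-- Along `L` the leading exponent is `-μ⁴ (s⁴ + s sin θ)`. With `c = cos((π + 2θ)/6)`, `sin θ` is a
cubic in `c`, and the Taylor coefficients at `tailStart θ` become nonnegative. The linear term makes
the tail integrable; the quadratic one is kept to absorb the contribution of `x`. -/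
lemma tailHeight_add_le {θ s : ℝ} (h1 : -(Real.pi / 2) ≤ θ) (h2 : θ ≤ Real.pi / 2)
    (hs : tailStart θ ≤ s) :
    tailHeight θ + (s - tailStart θ) + (s - tailStart θ) ^ 2 ≤ s ^ 4 + s * Real.sin θ := by
  have hc := half_le_cos_third h1 h2
  rw [sin_eq_cos_third]
  rw [tailHeight]
  rw [tailStart] at hs ⊢
  set c := Real.cos ((Real.pi + 2 * θ) / 6)
  have hk := kap_gt
  have h4 := four_kap_cube
  obtain ⟨d, rfl⟩ : ∃ d, s = 2 * kap * c + d := ⟨s - 2 * kap * c, by ring⟩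
  have hd : 0 ≤ d := by linarith
  have e : (2 * kap * c + d) ^ 4 + (2 * kap * c + d) * (3 * c - 4 * c ^ 3)
      = 2 * kap * (3 * c ^ 2 - 2 * c ^ 4) + d * (4 * c ^ 3 + 3 * c) + 24 * kap ^ 2 * c ^ 2 * d ^ 2
        + 8 * kap * c * d ^ 3 + d ^ 4 := by
    linear_combination (4 * kap * c ^ 4 + 8 * c ^ 3 * d) * h4
  rw [e]
  have a1 : d * 1 ≤ d * (4 * c ^ 3 + 3 * c) := by
    gcongr
    have : 0 ≤ c ^ 3 := by positivity
    linarith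
  have a2 : 1 * d ^ 2 ≤ 24 * kap ^ 2 * c ^ 2 * d ^ 2 := by
    gcongr
    have : (1 / 4 : ℝ) ≤ kap * c := by nlinarith
    nlinarith
  have a3 : 0 ≤ 8 * kap * c * d ^ 3 := by positivity
  have a4 : 0 ≤ d ^ 4 := by positivity
  linarith

lemma tailStart_sq_le (θ : ℝ) : tailStart θ ^ 2 ≤ 2 := by
  have hk := kap_lt
  have hk0 := kap_pos
  have h := Real.cos_sq_le_one ((Real.pi + 2 * θ) / 6)
  rw [tailStart, mul_pow]
  have : (2 * kap) ^ 2 ≤ 2 := by nlinarith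
  calc _ ≤ 2 * (1 : ℝ) := by gcongr
    _ = 2 := by norm_num

lemma norm_tail_le {θ μ R : ℝ} {x C : ℂ} (h1 : -(Real.pi / 2) ≤ θ) (h2 : θ ≤ Real.pi / 2)
    (hμ : 0 < μ) (hx : ‖x‖ ≤ R) (hR : 2 * R ≤ μ ^ 2) (hC : C.re = -(μ ^ 3 * Real.sin θ)) :
    ‖∫ s in Set.Ioi (tailStart θ), quarticExp 1 x C ((μ * s : ℝ) : ℂ)‖
      ≤ Real.exp (-(μ ^ 4 * tailHeight θ) + 4 * R * μ ^ 2) / μ ^ 4 := by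
  have hμ4 : 0 < μ ^ 4 := by positivity
  have hint : IntegrableOn (fun s => Real.exp (-(μ ^ 4 * tailHeight θ) + 4 * R * μ ^ 2
      + μ ^ 4 * tailStart θ) * Real.exp (-(μ ^ 4) * s)) (Set.Ioi (tailStart θ)) :=
    (integrableOn_exp_mul_Ioi (by linarith) _).const_mul _
  refine (norm_integral_le_of_norm_le hint ?_).trans (le_of_eq ?_)
  · refine (ae_restrict_iff' measurableSet_Ioi).2 (Eventually.of_forall fun s hs => ?_)
    have hs' : tailStart θ ≤ s := (Set.mem_Ioi.1 hs).le
    rw [quarticExp, Complex.norm_exp, ← Real.exp_add]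
    refine Real.exp_le_exp.2 ?_
    have e : (-1 * ((μ * s : ℝ) : ℂ) ^ 4 - x * ((μ * s : ℝ) : ℂ) ^ 2 + C * ((μ * s : ℝ) : ℂ)).re
        = -(μ * s) ^ 4 - x.re * (μ * s) ^ 2 + C.re * (μ * s) := by
      rw [← ofReal_pow, ← ofReal_pow, add_re, sub_re, re_mul_ofReal, re_mul_ofReal, re_mul_ofReal]
      simp
    rw [e, hC]
    have k1 := tailHeight_add_le h1 h2 hs'
    have k2 := tailStart_sq_le θ
    have k3 : -x.re ≤ R := (neg_le_abs _).trans ((abs_re_le_norm x).trans hx)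
    have hR0 : 0 ≤ R := (norm_nonneg x).trans hx
    have k4 : -x.re * (μ * s) ^ 2 ≤ R * (μ * s) ^ 2 := by gcongr
    -- Splits the term in `x` into the loss `4 R μ²` and a multiple of `(s - tailStart θ)²`, which
    -- the quadratic gain covers once `2R ≤ μ²`.
    have k5 : s ^ 2 ≤ 4 + 2 * (s - tailStart θ) ^ 2 := by
      nlinarith [sq_nonneg (s - 2 * tailStart θ)]
    have k6 : R * μ ^ 2 * s ^ 2 ≤ R * μ ^ 2 * (4 + 2 * (s - tailStart θ) ^ 2) := by gcongr
    have k7 : 2 * R * (μ ^ 2 * (s - tailStart θ) ^ 2) ≤ μ ^ 2 * (μ ^ 2 * (s - tailStart θ) ^ 2) := by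
      gcongr
    have k8 := mul_le_mul_of_nonneg_left k1 hμ4.le
    nlinarith
  · rw [integral_const_mul, integral_exp_mul_Ioi (by linarith), neg_div_neg_eq, ← mul_div_assoc,
      ← Real.exp_add]
    congr 2; ring

lemma im_eq {y : ℂ} : y.im = cbrtNorm y ^ 3 * Real.sin y.arg := by
  have h := norm_rpow_eq y 3
  norm_num at h
  rw [← h, norm_mul_sin_arg]

lemma norm_tailInt_le {x y : ℂ} {R : ℝ} (h1 : -(Real.pi / 2) ≤ y.arg) (h2 : y.arg ≤ Real.pi / 2)
    (hy : y ≠ 0) (hx : ‖x‖ ≤ R) (hR : 2 * R ≤ cbrtNorm y ^ 2) :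
    ‖tailInt x y‖ ≤ Real.exp (-(cbrtNorm y ^ 4 * tailHeight y.arg) + 4 * R * cbrtNorm y ^ 2)
      / cbrtNorm y ^ 4 := by
  simp only [tailInt, contourIntegrand_ray x hy]
  refine norm_tail_le h1 h2 (cbrtNorm_pos hy) hx hR ?_
  rw [← im_eq]; simp

lemma norm_tailInt'_le {x y : ℂ} {R : ℝ} (h1 : -(Real.pi / 2) ≤ y.arg) (h2 : y.arg ≤ Real.pi / 2)
    (hy : y ≠ 0) (hx : ‖x‖ ≤ R) (hR : 2 * R ≤ cbrtNorm y ^ 2) :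
    ‖tailInt' x y‖ ≤ Real.exp (-(cbrtNorm y ^ 4 * tailHeight (-y.arg)) + 4 * R * cbrtNorm y ^ 2)
      / cbrtNorm y ^ 4 := by
  have e : tailInt' x y = ∫ s in Set.Ioi (tailStart (-y.arg)),
      quarticExp 1 x (-(I * y)) ((cbrtNorm y * s : ℝ) : ℂ) := by
    simp only [tailInt', contourIntegrand_ray x hy]
    rw [← integral_comp_neg_Ioi]
    congr 1; ext s
    rw [quarticExp, quarticExp]
    congr 1; push_cast; ring
  rw [e]
  refine norm_tail_le (by linarith) (by linarith) (cbrtNorm_pos hy) hx hR ?_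
  rw [Real.sin_neg, mul_neg, ← im_eq]; simp

lemma tailHeight_eq_cos_two (θ : ℝ) : tailHeight θ = kap * (2 + Real.cos ((Real.pi + 2 * θ) / 3)
    - Real.cos ((Real.pi + 2 * θ) / 3) ^ 2) := by
  rw [tailHeight, show (Real.pi + 2 * θ) / 3 = 2 * ((Real.pi + 2 * θ) / 6) by ring, Real.cos_two_mul]
  ring

/-- A crude bound for use outside `|θ| ≤ π/8`, where only comparison with the dominant saddle
matters. -/
lemma half_le_tailHeight {θ : ℝ} (h1 : -(Real.pi / 2) ≤ θ) (h2 : θ ≤ Real.pi / 2) :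
    1 / 2 ≤ tailHeight θ := by
  have hc := half_le_cos_third h1 h2
  have h := Real.cos_le_one ((Real.pi + 2 * θ) / 6)
  have hk := kap_gt
  rw [tailHeight]
  set c := Real.cos ((Real.pi + 2 * θ) / 6)
  have hu : 1 / 4 ≤ c ^ 2 := by nlinarith
  have hu' : c ^ 2 ≤ 1 := by nlinarith
  have : 1 / 2 ≤ 3 * c ^ 2 - 2 * c ^ 4 := by nlinarith
  nlinarith

lemma κ_eq_tailHeight : κ = tailHeight (Real.pi / 8) := by
  have h := sin_eq_cos_third (Real.pi / 8)
  rw [κ, tailHeight]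
  rw [show (Real.pi + 2 * (Real.pi / 8)) / 6 = 5 * Real.pi / 24 by ring] at h ⊢
  have h4 := two_rpow_eq_kap 4
  norm_num at h4
  rw [h, h4, two_rpow_one_third]
  linear_combination (4 * kap * Real.cos (5 * Real.pi / 24) ^ 4) * four_kap_cube

lemma cos_five_pi_div_twelve : Real.cos (5 * Real.pi / 12) = √2 / 4 * (√3 - 1) := by
  rw [show 5 * Real.pi / 12 = Real.pi / 4 + Real.pi / 6 by ring, Real.cos_add, Real.cos_pi_div_four,
    Real.cos_pi_div_six, Real.sin_pi_div_four, Real.sin_pi_div_six]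
  ring

lemma cos_five_pi_div_twelve_bounds :
    0.258819 < Real.cos (5 * Real.pi / 12) ∧ Real.cos (5 * Real.pi / 12) < 0.25882 := by
  rw [cos_five_pi_div_twelve]
  have a1 : 1.41421356 < √2 := Real.lt_sqrt_of_sq_lt (by norm_num)
  have a2 : √2 < 1.41421357 := (Real.sqrt_lt' (by norm_num)).2 (by norm_num)
  have b1 : 1.7320508 < √3 := Real.lt_sqrt_of_sq_lt (by norm_num)
  have b2 : √3 < 1.73205081 := (Real.sqrt_lt' (by norm_num)).2 (by norm_num)
  constructor <;> nlinarith

lemma κ_eq_cos : κ = kap * (2 + Real.cos (5 * Real.pi / 12) - Real.cos (5 * Real.pi / 12) ^ 2) := by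
  rw [κ_eq_tailHeight, tailHeight_eq_cos_two,
    show (Real.pi + 2 * (Real.pi / 8)) / 3 = 5 * Real.pi / 12 by ring]

lemma κ_bounds : 1.38076 < κ ∧ κ < 1.38077 := by
  obtain ⟨h1, h2⟩ := cos_five_pi_div_twelve_bounds
  have k1 := kap_gt
  have k2 := kap_lt
  rw [κ_eq_cos]
  set v := Real.cos (5 * Real.pi / 12)
  have a1 : 2.19183 < 2 + v - v ^ 2 := by nlinarith
  have a2 : 2 + v - v ^ 2 < 2.191834 := by nlinarith
  constructor <;> nlinarith

/-- In `v = cos((π + 2θ)/3)` the height is the concave function `kap (2 + v - v²)`, and `v` runs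
between `cos(5π/12)` and `cos(π/4)`. These endpoints have sum below 1, so the minimum is at
`cos(5π/12)`, that is at `θ = π/8`. -/
lemma κ_le_tailHeight {θ : ℝ} (h1 : -(Real.pi / 8) ≤ θ) (h2 : θ ≤ Real.pi / 8) :
    κ ≤ tailHeight θ := by
  have hp := Real.pi_pos
  have a1 : Real.cos (5 * Real.pi / 12) ≤ Real.cos ((Real.pi + 2 * θ) / 3) :=
    Real.cos_le_cos_of_nonneg_of_le_pi (by linarith) (by linarith) (by linarith)
  have a2 : Real.cos ((Real.pi + 2 * θ) / 3) ≤ Real.cos (Real.pi / 4) :=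
    Real.cos_le_cos_of_nonneg_of_le_pi (by linarith) (by linarith) (by linarith)
  rw [Real.cos_pi_div_four] at a2
  have a3 : √2 < 1.4143 := (Real.sqrt_lt' (by norm_num)).2 (by norm_num)
  obtain ⟨h3, h4⟩ := cos_five_pi_div_twelve_bounds
  rw [κ_eq_cos, tailHeight_eq_cos_two]
  refine mul_le_mul_of_nonneg_left ?_ kap_pos.le
  nlinarith

lemma exists_le_cbrtNorm (M : ℝ) : ∃ Y : ℝ, 0 < Y ∧ ∀ y : ℂ, Y ≤ ‖y‖ → M ≤ cbrtNorm y ∧ y ≠ 0 := by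
  refine ⟨(max M 1) ^ 3, by positivity, fun y hy => ⟨?_, ?_⟩⟩
  · have h : (max M 1 ^ 3) ^ (1 / 3 : ℝ) ≤ cbrtNorm y :=
      Real.rpow_le_rpow (by positivity) hy (by norm_num)
    rw [← Real.rpow_natCast, ← Real.rpow_mul (by positivity)] at h
    norm_num at h
    exact h.1
  · rintro rfl
    have : 0 < max M 1 ^ 3 := by positivity
    rw [norm_zero] at hy
    linarith

lemma norm_P_sub_le (δ : ℝ) (hδ : δ < κ) (R : ℝ) : ∃ C Y : ℝ, 0 < Y ∧ ∀ x y : ℂ, ‖x‖ ≤ R → Y ≤ ‖y‖ →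
    |y.arg| ≤ Real.pi / 8 →
      ‖P x y - (P₁ x y + P₂ x y)‖ ≤ C * Real.exp (-δ * ‖y‖ ^ (4 / 3 : ℝ)) := by
  -- The bound `4R/(κ - δ)` lets the gap between `δ` and `κ` absorb the factor `exp(4Rμ²)`; the
  -- factor `μ` in front of the tails is paid by their denominator `μ⁴`.
  obtain ⟨Y, hY, h⟩ := exists_le_cbrtNorm (max 1 (max (2 * R) (4 * R / (κ - δ))))
  refine ⟨1, Y, hY, fun x y hx hy harg => ?_⟩
  obtain ⟨hM, hy0⟩ := h y hy
  obtain ⟨ha1, ha2⟩ := abs_le.1 harg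
  have hp := Real.pi_pos
  have h4 := norm_rpow_eq y 4
  norm_num at h4
  rw [P₁, P₂, if_neg (by linarith), if_neg (by linarith), h4, P_eq_segInt_add_tailInt x hy0, one_mul]
  have e : ∀ a b c d e : ℂ, a * (b + c) + d * e - (a * b + a * c) = d * e := fun a b c d e => by ring
  rw [← segInt₁, ← segInt₂, e, norm_mul, norm_div, Complex.norm_real, RCLike.norm_ofNat]
  simp only [max_le_iff] at hM
  obtain ⟨hm1, hm2, hm3⟩ := hM
  set μ := cbrtNorm y
  have hsq : μ ≤ μ ^ 2 := by nlinarith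
  have t1 := norm_tailInt_le (by linarith) (by linarith) hy0 hx (hm2.trans hsq)
  have t2 := norm_tailInt'_le (by linarith) (by linarith) hy0 hx (hm2.trans hsq)
  have hbound : ∀ H : ℝ, κ ≤ H → Real.exp (-(μ ^ 4 * H) + 4 * R * μ ^ 2) / μ ^ 4
      ≤ Real.exp (-δ * μ ^ 4) / μ := by
    intro H hH
    have k1 : 4 * R ≤ (κ - δ) * μ ^ 2 := by
      rw [div_le_iff₀ (by linarith)] at hm3
      nlinarith
    have k2 : 4 * R * μ ^ 2 ≤ (κ - δ) * μ ^ 2 * μ ^ 2 := by gcongr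
    have k3 : μ ^ 4 * κ ≤ μ ^ 4 * H := by gcongr
    have k4 : μ ≤ μ ^ 4 := le_self_pow₀ hm1 (by norm_num)
    gcongr
    nlinarith
  have b1 := t1.trans (hbound _ (κ_le_tailHeight ha1 ha2))
  have b2 := t2.trans (hbound _ (κ_le_tailHeight (by linarith) (by linarith)))
  rw [Real.norm_of_nonneg (by linarith)]
  calc μ / 2 * ‖tailInt x y + tailInt' x y‖
      ≤ μ / 2 * (Real.exp (-δ * μ ^ 4) / μ + Real.exp (-δ * μ ^ 4) / μ) := by
        gcongr
        exact norm_add_le_of_le b1 b2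
    _ = Real.exp (-δ * μ ^ 4) := by field_simp; ring

/-! ### Expansion of the perturbed Gaussian integral -/

/-- The truncated exponential series of `η p + η² q`, reordered by powers of `η`. -/
def truncCoeff (n : ℕ) (p q : ℂ) : ℂ :=
  ∑ m ∈ Finset.Icc ((n + 1) / 2) n,
    p ^ (2 * m - n) * q ^ (n - m) / (((2 * m - n).factorial : ℂ) * ((n - m).factorial : ℂ))

/-- The part of the truncated exponential series of `η p + η² q` of order at least `N`. -/
def truncRest (N : ℕ) (p q η : ℂ) : ℂ :=
  ∑ m ∈ Finset.range N, ∑ l ∈ Finset.range (m + 1),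
    if N ≤ m + l then
      η ^ (m + l) * (p ^ (m - l) * q ^ l / (((m - l).factorial : ℂ) * (l.factorial : ℂ))) else 0

lemma pow_div_factorial_eq (p q η : ℂ) (m : ℕ) :
    (η * p + η ^ 2 * q) ^ m / (m.factorial : ℂ) = ∑ l ∈ Finset.range (m + 1),
      η ^ (m + l) * (p ^ (m - l) * q ^ l / (((m - l).factorial : ℂ) * (l.factorial : ℂ))) := by
  rw [add_comm (η * p), add_pow, Finset.sum_div]
  refine Finset.sum_congr rfl fun l hl => ?_
  have hl' : l ≤ m := by simpa [Nat.lt_succ_iff] using hl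
  have h (j : ℕ) : (j.factorial : ℂ) ≠ 0 := by exact_mod_cast j.factorial_ne_zero
  have hm := h m
  have h1 := h l
  have h2 := h (m - l)
  rw [Nat.cast_choose ℂ hl']
  obtain ⟨d, rfl⟩ := Nat.exists_eq_add_of_le hl'
  rw [Nat.add_sub_cancel_left] at *
  field_simp
  ring

lemma sum_pow_div_factorial_eq (p q η : ℂ) (N : ℕ) :
    ∑ m ∈ Finset.range N, (η * p + η ^ 2 * q) ^ m / (m.factorial : ℂ)
      = ∑ n ∈ Finset.range N, η ^ n * truncCoeff n p q + truncRest N p q η := by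
  simp only [pow_div_factorial_eq, truncRest, truncCoeff, Finset.mul_sum]
  rw [← sub_eq_iff_eq_add, ← Finset.sum_sub_distrib]
  simp only [← Finset.sum_sub_distrib]
  have e : ∀ m ∈ Finset.range N, ∀ F : ℕ → ℂ,
      ∑ l ∈ Finset.range (m + 1), (F l - if N ≤ m + l then F l else 0)
        = ∑ l ∈ (Finset.range (m + 1)).filter (fun l => m + l < N), F l := by
    intro m _ F
    rw [Finset.sum_filter]
    refine Finset.sum_congr rfl fun l _ => ?_
    split_ifs <;> first | omega | simp
  rw [Finset.sum_congr rfl fun m hm => e m hm _, Finset.sum_sigma', Finset.sum_sigma']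
  -- Reindexing by total order in `η`: `m` counts all factors and `l` those equal to `η² q`, so the
  -- order is `n = m + l`.
  refine Finset.sum_bij' (fun a _ => ⟨a.1 + a.2, a.1⟩) (fun b _ => ⟨b.2, b.1 - b.2⟩) ?_ ?_ ?_ ?_ ?_
  · rintro ⟨m, l⟩ h
    simp only [Finset.mem_sigma, Finset.mem_range, Finset.mem_filter, Finset.mem_Icc] at h ⊢
    omega
  · rintro ⟨n, m⟩ h
    simp only [Finset.mem_sigma, Finset.mem_range, Finset.mem_filter, Finset.mem_Icc] at h ⊢
    omega
  · rintro ⟨m, l⟩ h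
    simp
  · rintro ⟨n, m⟩ h
    simp only [Finset.mem_sigma, Finset.mem_range, Finset.mem_Icc] at h
    simp only [Sigma.mk.injEq, heq_eq_eq, and_true]
    omega
  · rintro ⟨m, l⟩ h
    simp only [Finset.mem_sigma, Finset.mem_range, Finset.mem_filter] at h
    rw [show 2 * m - (m + l) = m - l by omega, show m + l - m = l by omega]

lemma norm_monomial_le {p q : ℂ} {M : ℝ} (hM : 1 ≤ M) (hp : ‖p‖ ≤ M) (hq : ‖q‖ ≤ M) {i j N : ℕ}
    (hij : i + j ≤ N) : ‖p ^ i * q ^ j / ((i.factorial : ℂ) * (j.factorial : ℂ))‖ ≤ M ^ N := by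
  rw [norm_div, norm_mul, norm_mul, norm_pow, norm_pow, Complex.norm_natCast, Complex.norm_natCast]
  have h : (1 : ℝ) ≤ (i.factorial : ℝ) * (j.factorial : ℝ) := by
    exact_mod_cast Nat.succ_le_of_lt (Nat.mul_pos i.factorial_pos j.factorial_pos)
  calc _ ≤ ‖p‖ ^ i * ‖q‖ ^ j := div_le_self (by positivity) h
    _ ≤ M ^ i * M ^ j := by gcongr
    _ = M ^ (i + j) := (pow_add _ _ _).symm
    _ ≤ M ^ N := pow_le_pow_right₀ hM hij

lemma norm_truncCoeff_le {p q : ℂ} {M : ℝ} (hM : 1 ≤ M) (hp : ‖p‖ ≤ M) (hq : ‖q‖ ≤ M) {n N : ℕ}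
    (hn : n < N) : ‖truncCoeff n p q‖ ≤ N * M ^ N := by
  refine (norm_sum_le _ _).trans ((Finset.sum_le_card_nsmul _ _ (M ^ N) fun m hm => ?_).trans ?_)
  · rw [Finset.mem_Icc] at hm
    exact norm_monomial_le hM hp hq (by omega)
  · rw [nsmul_eq_mul, Nat.card_Icc]
    gcongr
    omega

lemma norm_sum_truncCoeff_le {p q η : ℂ} {M : ℝ} (hM : 1 ≤ M) (hp : ‖p‖ ≤ M) (hq : ‖q‖ ≤ M)
    (hη : ‖η‖ ≤ 1) (N : ℕ) :
    ‖∑ n ∈ Finset.range N, η ^ n * truncCoeff n p q‖ ≤ N * (N * M ^ N) := by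
  refine (norm_sum_le _ _).trans ((Finset.sum_le_card_nsmul _ _ (N * M ^ N) fun n hn => ?_).trans ?_)
  · rw [Finset.mem_range] at hn
    rw [norm_mul, norm_pow]
    have := norm_truncCoeff_le hM hp hq hn
    calc _ ≤ 1 * (N * M ^ N) := by
          gcongr
          exact pow_le_one₀ (norm_nonneg _) hη
      _ = _ := one_mul _
  · rw [nsmul_eq_mul, Finset.card_range]

lemma norm_truncRest_le {p q η : ℂ} {M : ℝ} (hM : 1 ≤ M) (hp : ‖p‖ ≤ M) (hq : ‖q‖ ≤ M)
    (hη : ‖η‖ ≤ 1) (N : ℕ) : ‖truncRest N p q η‖ ≤ ‖η‖ ^ N * (N * (N * M ^ N)) := by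
  have hM0 : 0 ≤ ‖η‖ ^ N * M ^ N := by positivity
  have hb : ∀ m ∈ Finset.range N, ‖∑ l ∈ Finset.range (m + 1),
    if N ≤ m + l then
      η ^ (m + l) * (p ^ (m - l) * q ^ l / (((m - l).factorial : ℂ) * (l.factorial : ℂ))) else 0‖
      ≤ N * (‖η‖ ^ N * M ^ N) := by
    intro m hm
    rw [Finset.mem_range] at hm
    refine (norm_sum_le _ _).trans
      ((Finset.sum_le_card_nsmul _ _ (‖η‖ ^ N * M ^ N) fun l hl => ?_).trans ?_)
    · rw [Finset.mem_range] at hl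
      split_ifs with h
      · rw [norm_mul, norm_pow]
        exact mul_le_mul (pow_le_pow_of_le_one (norm_nonneg _) hη h)
          (norm_monomial_le hM hp hq (by omega)) (norm_nonneg _) (by positivity)
      · simpa using hM0
    · rw [nsmul_eq_mul, Finset.card_range]
      gcongr
      omega
  refine (norm_sum_le _ _).trans ((Finset.sum_le_card_nsmul _ _ _ hb).trans (le_of_eq ?_))
  rw [nsmul_eq_mul, Finset.card_range]
  ring

/-- The coefficient of `η` in the perturbation of the Gaussian exponent. -/
def pertLin (x : ℂ) (u : ℝ) : ℂ := -(4 * kap * (u : ℂ) ^ 3 + x * (u : ℂ) ^ 2)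

/-- The coefficient of `η²` in the perturbation of the Gaussian exponent. -/
def pertQuad (u : ℝ) : ℂ := -(u : ℂ) ^ 4

/-- The unperturbed Gaussian. -/
def baseGauss (x : ℂ) (u : ℝ) : ℂ := exp (-(6 * (kap : ℂ) ^ 2) * (u : ℂ) ^ 2 - 2 * kap * x * u)

/-- The perturbation of the Gaussian exponent. -/
def pert (x η : ℂ) (u : ℝ) : ℂ := η * pertLin x u + η ^ 2 * pertQuad u

lemma norm_pertLin_le {x : ℂ} {R : ℝ} (hx : ‖x‖ ≤ R) (u : ℝ) :
    ‖pertLin x u‖ ≤ (5 + R) * (1 + |u|) ^ 4 := by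
  have hu := abs_nonneg u
  have hR : 0 ≤ R := (norm_nonneg x).trans hx
  have hk := kap_lt_one
  have hk0 := kap_pos
  rw [pertLin, norm_neg]
  refine (norm_add_le _ _).trans ?_
  rw [norm_mul, norm_mul, norm_mul, norm_pow, norm_pow, Complex.norm_real, Complex.norm_real,
    Real.norm_eq_abs, Real.norm_eq_abs, abs_of_pos hk0, RCLike.norm_ofNat]
  have h3 : |u| ^ 3 ≤ (1 + |u|) ^ 4 :=
    (pow_le_pow_left₀ hu (by linarith) 3).trans (pow_le_pow_right₀ (by linarith) (by norm_num))
  have h2 : |u| ^ 2 ≤ (1 + |u|) ^ 4 :=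
    (pow_le_pow_left₀ hu (by linarith) 2).trans (pow_le_pow_right₀ (by linarith) (by norm_num))
  have a1 : 4 * kap * |u| ^ 3 ≤ 4 * 1 * (1 + |u|) ^ 4 := by gcongr
  have a2 : ‖x‖ * |u| ^ 2 ≤ R * (1 + |u|) ^ 4 := by gcongr
  have a3 : 0 ≤ (1 + |u|) ^ 4 := by positivity
  linarith

lemma norm_pertQuad_le {R : ℝ} (hR : 0 ≤ R) (u : ℝ) :
    ‖pertQuad u‖ ≤ (5 + R) * (1 + |u|) ^ 4 := by
  have hu := abs_nonneg u
  rw [pertQuad, norm_neg, norm_pow, Complex.norm_real, Real.norm_eq_abs]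
  have h4 : |u| ^ 4 ≤ (1 + |u|) ^ 4 := by gcongr; linarith
  have a3 : 0 ≤ (1 + |u|) ^ 4 := by positivity
  nlinarith

lemma norm_baseGauss_le {x : ℂ} {R : ℝ} (hx : ‖x‖ ≤ R) (u : ℝ) :
    ‖baseGauss x u‖ ≤ Real.exp (-(1 / 8) * u ^ 2 + 4 * R * |u|) := by
  have hk := kap_gt
  have hk1 := kap_lt_one
  rw [baseGauss, Complex.norm_exp]
  refine Real.exp_le_exp.2 ?_
  have e : (-(6 * (kap : ℂ) ^ 2) * (u : ℂ) ^ 2 - 2 * kap * x * u).re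
      = -(6 * kap ^ 2) * u ^ 2 - 2 * kap * (x.re * u) := by
    rw [show -(6 * (kap : ℂ) ^ 2) * (u : ℂ) ^ 2 - 2 * kap * x * u
      = ((-(6 * kap ^ 2) * u ^ 2 : ℝ) : ℂ) - ((2 * kap : ℝ) : ℂ) * (x * u) by push_cast; ring,
      sub_re, ofReal_re, re_ofReal_mul, re_mul_ofReal]
  rw [e]
  have h1 : -(x.re * u) ≤ R * |u| := by
    refine (neg_le_abs _).trans ?_
    rw [abs_mul]
    gcongr
    exact (abs_re_le_norm x).trans hx
  have h0 : 0 ≤ R * |u| := mul_nonneg ((norm_nonneg x).trans hx) (abs_nonneg u)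
  have h2 : 2 * kap * -(x.re * u) ≤ 2 * kap * (R * |u|) := by gcongr
  have h3 : 2 * kap * (R * |u|) ≤ 2 * 1 * (R * |u|) := by gcongr
  have h4 : 1 / 8 * u ^ 2 ≤ 6 * kap ^ 2 * u ^ 2 := by gcongr; nlinarith
  linarith

/-- With `u = kap lam ρ` and `c = Re w`, the part of the exponent free of `x` has real part `-kap²
u²` times this quadratic. The vertices are `ρ = -2c` (on `C₂`) and `ρ = 1` (on `L`). The quadratic
equals `4 + 2(1 + cρ)² - ρ²`, where only `ρ` near `-2` is delicate; there `c ≥ -ρ/2` keeps `(1 +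
cρ)²` away from zero. -/
lemma re_quadratic_ge {c ρ : ℝ} (h1 : -(2 * c) ≤ ρ) (h2 : ρ ≤ 1) (hc : c ≤ 1) :
    1 / 2 ≤ 6 + 4 * c * ρ + (2 * c ^ 2 - 1) * ρ ^ 2 := by
  have e : 6 + 4 * c * ρ + (2 * c ^ 2 - 1) * ρ ^ 2 = 4 + 2 * (1 + c * ρ) ^ 2 - ρ ^ 2 := by ring
  rw [e]
  by_cases h : ρ ^ 2 ≤ 3
  · nlinarith [sq_nonneg (1 + c * ρ)]
  · push Not at h
    have hρ : ρ < 0 := by nlinarith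
    have h3 : 3 / 2 ≤ -(c * ρ) := by nlinarith
    have h4 : ρ ^ 2 ≤ 4 := by nlinarith
    nlinarith

lemma re_sq_of_norm_eq_one {w : ℂ} (hw : ‖w‖ = 1) : (w ^ 2).re = 2 * w.re ^ 2 - 1 := by
  have h := Complex.sq_norm w
  rw [hw, normSq_apply] at h
  rw [sq, mul_re]
  nlinarith

/-- The Gaussian bound on the segment between the intersection points. -/
lemma norm_baseGauss_mul_exp_pert_le {x w : ℂ} {R lam u : ℝ} (hx : ‖x‖ ≤ R) (hw : ‖w‖ = 1)
    (hlam : 1 ≤ lam) (hl : -(2 * kap * w.re * lam) ≤ u) (hr : u ≤ kap * lam) :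
    ‖baseGauss x u * exp (pert x (w / lam) u)‖ ≤ Real.exp (-(1 / 8) * u ^ 2 + 4 * R * |u|) := by
  have hk := kap_gt
  have hk1 := kap_lt
  have hk0 := kap_pos
  have hlam0 : 0 < lam := by linarith
  have hlamc : (lam : ℂ) ≠ 0 := ofReal_ne_zero.2 hlam0.ne'
  rw [baseGauss, ← Complex.exp_add, Complex.norm_exp]
  refine Real.exp_le_exp.2 ?_
  obtain ⟨ρ, rfl⟩ : ∃ ρ, u = kap * lam * ρ := ⟨u / (kap * lam), by field_simp⟩
  have hρ1 : -(2 * w.re) ≤ ρ := by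
    have : 0 < kap * lam := by positivity
    nlinarith
  have hρ2 : ρ ≤ 1 := by
    have : 0 < kap * lam := by positivity
    nlinarith
  have hc : w.re ≤ 1 := (re_le_norm w).trans hw.le
  have hQ := re_quadratic_ge hρ1 hρ2 hc
  have e : (-(6 * (kap : ℂ) ^ 2) * ((kap * lam * ρ : ℝ) : ℂ) ^ 2
        - 2 * kap * x * ((kap * lam * ρ : ℝ) : ℂ) + pert x (w / lam) (kap * lam * ρ))
      = ((-(6 * kap ^ 2) * (kap * lam * ρ) ^ 2 : ℝ) : ℂ)
        - ((2 * kap * (kap * lam * ρ) : ℝ) : ℂ) * x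
        - ((4 * kap * (kap * lam * ρ) ^ 2 * (kap * ρ) : ℝ) : ℂ) * w
        - (((kap * lam * ρ) ^ 2 * (kap * ρ) ^ 2 : ℝ) : ℂ) * w ^ 2
        - (((kap * lam * ρ) * (kap * ρ) : ℝ) : ℂ) * (x * w) := by
    rw [pert, pertLin, pertQuad]
    push_cast
    field_simp
    ring
  rw [e, sub_re, sub_re, sub_re, sub_re, ofReal_re, re_ofReal_mul, re_ofReal_mul, re_ofReal_mul,
    re_ofReal_mul, re_sq_of_norm_eq_one hw]
  set u := kap * lam * ρ
  have b1 : -(2 * kap * u * x.re) ≤ 2 * R * |u| := by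
    refine (neg_le_abs _).trans ?_
    rw [abs_mul, abs_mul, abs_of_pos (by positivity : 0 < 2 * kap)]
    have h1 : |x.re| ≤ R := (abs_re_le_norm x).trans hx
    have h2 : 2 * kap ≤ 2 := by linarith
    calc 2 * kap * |u| * |x.re| ≤ 2 * |u| * R := by gcongr
      _ = _ := by ring
  have hρ3 : |ρ| ≤ 2 := abs_le.2 ⟨by linarith, by linarith⟩
  have b2 : -(u * (kap * ρ) * (x * w).re) ≤ 2 * R * |u| := by
    refine (neg_le_abs _).trans ?_
    rw [abs_mul (u * _), abs_mul u, abs_mul kap, abs_of_pos hk0]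
    have h1 : |(x * w).re| ≤ R := by
      refine (abs_re_le_norm _).trans ?_
      rw [norm_mul, hw, mul_one]; exact hx
    calc |u| * (kap * |ρ|) * |(x * w).re| ≤ |u| * (1 * 2) * R := by gcongr; linarith
      _ = _ := by ring
  have b3 : u ^ 2 * (1 / 8) ≤ u ^ 2 * (kap ^ 2 * (6 + 4 * w.re * ρ + (2 * w.re ^ 2 - 1) * ρ ^ 2)) := by
    gcongr
    nlinarith
  nlinarith

lemma continuous_baseGauss_mul_exp_pert (x η : ℂ) :
    Continuous fun u : ℝ => baseGauss x u * exp (pert x η u) := by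
  unfold baseGauss pert pertLin pertQuad; fun_prop

/-- The perturbed Gaussian integral over the segment. -/
def gaussSeg (x w : ℂ) (lam : ℝ) : ℂ :=
  ∫ u in (-(2 * kap * w.re * lam))..(kap * lam), baseGauss x u * exp (pert x (w / lam) u)

/-- The condition `Re w ≥ -1/2` says that the left endpoint does not exceed the right one. This
generality is needed for the second segment, which shrinks to a point as `θ → -π/2`. -/
lemma norm_gaussSeg_le (R : ℝ) : ∃ K : ℝ, 0 ≤ K ∧ ∀ (x w : ℂ) (lam : ℝ), ‖x‖ ≤ R → ‖w‖ = 1 →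
    -(1 / 2) ≤ w.re → 1 ≤ lam → ‖gaussSeg x w lam‖ ≤ K := by
  obtain ⟨K, hK0, hK⟩ := exists_gaussian_dominates 0 (4 * R) (c := 1 / 8) (by norm_num)
  have hint := (integrable_exp_neg_mul_sq (b := 1 / 8 / 2) (by norm_num)).const_mul K
  refine ⟨∫ u : ℝ, K * Real.exp (-(1 / 8 / 2) * u ^ 2), integral_nonneg fun u => by positivity,
    fun x w lam hx hw hwr hlam => ?_⟩
  have hab : -(2 * kap * w.re * lam) ≤ kap * lam := by
    have := mul_pos kap_pos (by linarith : 0 < lam)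
    nlinarith
  rw [gaussSeg, intervalIntegral.integral_of_le hab]
  refine (norm_integral_le_of_norm_le hint.integrableOn ?_).trans
    (setIntegral_le_integral hint (Eventually.of_forall fun u => by positivity))
  refine (ae_restrict_iff' measurableSet_Ioc).2 (Eventually.of_forall fun u hu => ?_)
  refine (norm_baseGauss_mul_exp_pert_le hx hw hlam hu.1.le hu.2).trans ?_
  simpa using hK u

/-- The linear term in `baseGauss` has the sign opposite to that in `c_n`; the reflection `u ↦ -u`
produces the sign `(-1)^{n+k}` in `A_n`. -/
lemma integral_baseGauss_mul_pow (x : ℂ) (n : ℕ) :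
    Integrable (fun u : ℝ => baseGauss x u * (u : ℂ) ^ n) ∧
    ∫ u : ℝ, baseGauss x u * (u : ℂ) ^ n = exp (x ^ 2 / 6) / momentNorm * ((-1) ^ n * c n x) := by
  have hm : (momentNorm : ℂ) ≠ 0 := ofReal_ne_zero.2 momentNorm_pos.ne'
  have e : (fun u : ℝ => baseGauss x u * (u : ℂ) ^ n)
      = fun u : ℝ => (-1) ^ n * momentIntegrand n x (-u) := by
    ext u
    rw [momentIntegrand_eq, baseGauss, mul_left_comm, ← mul_pow]
    congr 1
    · congr 1; push_cast; ring
    · push_cast; ring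
  constructor
  · rw [e]
    exact (integrable_momentIntegrand n x).comp_neg.const_mul _
  · rw [e, integral_const_mul, integral_neg_eq_self (fun u => momentIntegrand n x u) volume, ← moment,
      c_eq]
    have h : exp (x ^ 2 / 6) * exp (-x ^ 2 / 6) = 1 := by
      rw [← Complex.exp_add]; ring_nf; simp
    generalize exp (x ^ 2 / 6) = p at h ⊢
    generalize exp (-x ^ 2 / 6) = q at h ⊢
    field_simp
    linear_combination (-moment n x) * h

lemma truncCoeff_pert (n : ℕ) (x : ℂ) (u : ℝ) : truncCoeff n (pertLin x u) (pertQuad u) =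
    ∑ m ∈ Finset.Icc ((n + 1) / 2) n, ∑ k ∈ Finset.range (2 * m - n + 1),
      a n m k x * (u : ℂ) ^ (2 * m + n - k) := by
  refine Finset.sum_congr rfl fun m hm => ?_
  rw [Finset.mem_Icc] at hm
  obtain ⟨i, hi⟩ : ∃ i, i = 2 * m - n := ⟨_, rfl⟩
  obtain ⟨l, hl⟩ : ∃ l, l = n - m := ⟨_, rfl⟩
  rw [← hi, ← hl, pertLin, pertQuad, neg_pow, neg_pow, add_comm, add_pow, Finset.mul_sum,
    Finset.sum_mul, Finset.sum_div]
  refine Finset.sum_congr rfl fun k hk => ?_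
  rw [Finset.mem_range, Nat.lt_succ_iff] at hk
  obtain ⟨j, rfl⟩ := Nat.exists_eq_add_of_le hk
  have hfac (b : ℕ) : (b.factorial : ℂ) ≠ 0 := by exact_mod_cast b.factorial_ne_zero
  have h1 := hfac k
  have h2 := hfac j
  have h3 := hfac l
  have h4 := hfac (k + j)
  have hpow : (2 : ℝ) ^ (4 * (j : ℝ) / 3) = (4 * kap) ^ j := by
    have h := two_rpow_eq_kap (4 * j)
    push_cast at h
    rw [h, pow_mul]
    congr 1
    linear_combination (4 * kap) * four_kap_cube
  -- Here `k`, `j`, `l` count the factors `x u²`, `4 kap u³` and `u⁴`; writing `m` and `n` through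
  -- them removes truncated subtraction.
  have hm' : m = k + j + l := by omega
  have hn' : n = k + j + 2 * l := by omega
  rw [a, Nat.cast_choose ℂ hk, ← hi, ← hl, Nat.add_sub_cancel_left, hpow,
    show 2 * m + n - k = 2 * k + 3 * j + 4 * l by omega, hm']
  push_cast
  field_simp
  ring

lemma integral_truncCoeff_pert (n : ℕ) (x : ℂ) :
    Integrable (fun u : ℝ => baseGauss x u * truncCoeff n (pertLin x u) (pertQuad u)) ∧
    ∫ u : ℝ, baseGauss x u * truncCoeff n (pertLin x u) (pertQuad u)
      = exp (x ^ 2 / 6) / momentNorm * A n x := by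
  have e : (fun u : ℝ => baseGauss x u * truncCoeff n (pertLin x u) (pertQuad u)) = fun u : ℝ =>
      ∑ m ∈ Finset.Icc ((n + 1) / 2) n, ∑ k ∈ Finset.range (2 * m - n + 1),
        a n m k x * (baseGauss x u * (u : ℂ) ^ (2 * m + n - k)) := by
    ext u
    rw [truncCoeff_pert, Finset.mul_sum]
    refine Finset.sum_congr rfl fun m _ => ?_
    rw [Finset.mul_sum]
    exact Finset.sum_congr rfl fun k _ => by ring
  have hint (m k : ℕ) : Integrable
      fun u : ℝ => a n m k x * (baseGauss x u * (u : ℂ) ^ (2 * m + n - k)) :=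
    (integral_baseGauss_mul_pow x _).1.const_mul _
  rw [e]
  refine ⟨integrable_finsetSum _ fun m _ => integrable_finsetSum _ fun k _ => hint m k, ?_⟩
  rw [integral_finsetSum _ fun m _ => integrable_finsetSum _ fun k _ => hint m k, A, Finset.mul_sum]
  refine Finset.sum_congr rfl fun m hm => ?_
  rw [integral_finsetSum _ fun k _ => hint m k, Finset.mul_sum]
  refine Finset.sum_congr rfl fun k hk => ?_
  rw [Finset.mem_Icc] at hm
  rw [Finset.mem_range] at hk
  rw [integral_const_mul, (integral_baseGauss_mul_pow x _).2]
  have hs : ((-1 : ℂ)) ^ (2 * m + n - k) = (-1) ^ (n + k) :=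
    neg_one_pow_congr (by rw [Nat.even_iff, Nat.even_iff]; omega)
  rw [hs]
  ring

/-- Pointwise estimate of the remainder of the expansion of the perturbed Gaussian. -/
lemma norm_gauss_remainder_le {x w : ℂ} {R lam : ℝ} (N : ℕ) (hx : ‖x‖ ≤ R) (hw : ‖w‖ = 1)
    (hwr : 1 / 4 ≤ w.re) (hlam : 1 ≤ lam) (u : ℝ) :
    ‖(Set.Ioc (-(2 * kap * w.re * lam)) (kap * lam)).indicator
        (fun u : ℝ => baseGauss x u * exp (pert x (w / lam) u)) u
      - ∑ n ∈ Finset.range N, (w / lam) ^ n *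
        (baseGauss x u * truncCoeff n (pertLin x u) (pertQuad u))‖
    ≤ (2 ^ N + N * N + N * N * 4 ^ N) * (5 + R) ^ (2 * N) / lam ^ N *
      ((1 + |u|) ^ (8 * N) * Real.exp (-(1 / 8) * u ^ 2 + 4 * R * |u|)) := by
  have hR : 0 ≤ R := (norm_nonneg x).trans hx
  have hu := abs_nonneg u
  have hlam0 : 0 < lam := by linarith
  -- One quantity dominates `p`, `q` and `1 + |u|`. The three summands of the constant come from the
  -- Taylor remainder, from the terms of order at least `N`, and from the complement of the segment.
  obtain ⟨M, hMdef⟩ : ∃ M, M = (5 + R) * (1 + |u|) ^ 4 := ⟨_, rfl⟩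
  obtain ⟨D, hD⟩ : ∃ D, D = Real.exp (-(1 / 8) * u ^ 2 + 4 * R * |u|) := ⟨_, rfl⟩
  have hD0 : 0 ≤ D := hD ▸ Real.exp_nonneg _
  have hp : ‖pertLin x u‖ ≤ M := hMdef ▸ norm_pertLin_le hx u
  have hq : ‖pertQuad u‖ ≤ M := hMdef ▸ norm_pertQuad_le hR u
  have huM : 1 + |u| ≤ M := by
    have : 1 + |u| ≤ (1 + |u|) ^ 4 := le_self_pow₀ (by linarith) (by norm_num)
    rw [hMdef]
    nlinarith
  have hM : 1 ≤ M := by linarith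
  have hMN : M ^ N ≤ M ^ (2 * N) := pow_le_pow_right₀ hM (by omega)
  have hη : ‖w / (lam : ℂ)‖ = 1 / lam := by
    rw [norm_div, hw, Complex.norm_real, Real.norm_of_nonneg hlam0.le]
  have hη1 : ‖w / (lam : ℂ)‖ ≤ 1 := by rw [hη, div_le_one hlam0]; exact hlam
  have hηN : ‖w / (lam : ℂ)‖ ^ N = 1 / lam ^ N := by rw [hη, div_pow, one_pow]
  have hbase : ‖baseGauss x u‖ ≤ D := hD ▸ norm_baseGauss_le hx u
  set η := w / (lam : ℂ) with hηdef
  have hMeq : (5 + R) ^ (2 * N) * (1 + |u|) ^ (8 * N) = M ^ (2 * N) := by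
    rw [hMdef, mul_pow, ← pow_mul]; congr 2; ring
  have hgoal : (2 ^ N + N * N + N * N * 4 ^ N) * (5 + R) ^ (2 * N) / lam ^ N * ((1 + |u|) ^ (8 * N) * D)
      = (2 ^ N + N * N + N * N * 4 ^ N) * M ^ (2 * N) * D / lam ^ N := by
    rw [← hMeq]; ring
  have hsum : ∑ n ∈ Finset.range N, η ^ n * (baseGauss x u * truncCoeff n (pertLin x u) (pertQuad u))
      = baseGauss x u * ∑ n ∈ Finset.range N, η ^ n * truncCoeff n (pertLin x u) (pertQuad u) := by
    rw [Finset.mul_sum]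
    exact Finset.sum_congr rfl fun n _ => by ring
  rw [← hD, hgoal, hsum]
  by_cases hmem : u ∈ Set.Ioc (-(2 * kap * w.re * lam)) (kap * lam)
  · rw [Set.indicator_of_mem hmem]
    have e : baseGauss x u * exp (pert x η u)
        - baseGauss x u * ∑ n ∈ Finset.range N, η ^ n * truncCoeff n (pertLin x u) (pertQuad u)
        = baseGauss x u * (exp (pert x η u)
            - ∑ j ∈ Finset.range N, pert x η u ^ j / (j.factorial : ℂ))
          + baseGauss x u * truncRest N (pertLin x u) (pertQuad u) η := by
      simp only [pert]
      rw [sum_pow_div_factorial_eq]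
      ring
    have hS : ‖pert x η u‖ ≤ ‖η‖ * (2 * M) := by
      have : pert x η u = η * (pertLin x u + η * pertQuad u) := by rw [pert]; ring
      rw [this, norm_mul]
      gcongr
      refine (norm_add_le _ _).trans ?_
      rw [norm_mul]
      have : ‖η‖ * ‖pertQuad u‖ ≤ 1 * M := by gcongr
      linarith
    -- Both the Gaussian and the perturbed Gaussian lie under the same majorant, so the maximum in
    -- the Taylor remainder is harmless.
    have hmax : ‖baseGauss x u‖ * max 1 (Real.exp (pert x η u).re) ≤ D := by
      rw [mul_max_of_nonneg _ _ (norm_nonneg _), mul_one, ← Complex.norm_exp, ← norm_mul]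
      exact max_le hbase (hD ▸ norm_baseGauss_mul_exp_pert_le hx hw hlam hmem.1.le hmem.2)
    have b1 : ‖baseGauss x u * (exp (pert x η u)
            - ∑ j ∈ Finset.range N, pert x η u ^ j / (j.factorial : ℂ))‖
          ≤ 2 ^ N * M ^ (2 * N) * D / lam ^ N := by
      rw [norm_mul]
      calc _ ≤ ‖baseGauss x u‖ * (‖pert x η u‖ ^ N * max 1 (Real.exp (pert x η u).re)) := by
            gcongr; exact norm_exp_sub_sum_le N _
        _ = ‖pert x η u‖ ^ N * (‖baseGauss x u‖ * max 1 (Real.exp (pert x η u).re)) := by ring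
        _ ≤ (‖η‖ * (2 * M)) ^ N * D := by gcongr
        _ = 2 ^ N * M ^ N * D / lam ^ N := by rw [mul_pow, hηN, mul_pow]; ring
        _ ≤ _ := by gcongr
    have b2 : ‖baseGauss x u * truncRest N (pertLin x u) (pertQuad u) η‖
          ≤ N * N * M ^ (2 * N) * D / lam ^ N := by
      rw [norm_mul]
      calc _ ≤ D * (‖η‖ ^ N * (N * (N * M ^ N))) := by
            gcongr; exact norm_truncRest_le hM hp hq hη1 N
        _ = N * N * M ^ N * D / lam ^ N := by rw [hηN]; ring
        _ ≤ _ := by gcongr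
    rw [e]
    have b3 : 0 ≤ N * N * 4 ^ N * M ^ (2 * N) * D / lam ^ N := by positivity
    calc _ ≤ 2 ^ N * M ^ (2 * N) * D / lam ^ N + N * N * M ^ (2 * N) * D / lam ^ N :=
          norm_add_le_of_le b1 b2
      _ ≤ 2 ^ N * M ^ (2 * N) * D / lam ^ N + N * N * M ^ (2 * N) * D / lam ^ N
          + N * N * 4 ^ N * M ^ (2 * N) * D / lam ^ N := by linarith
      _ = _ := by ring
  · rw [Set.indicator_of_notMem hmem, zero_sub, norm_neg, norm_mul]
    -- Both endpoints are at distance at least `lam/4` from 0. Off the segment `1 ≤ (4M/lam)^N`, so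
    -- the truncated series itself counts as an error of order `lam^{-N}`.
    have hlarge : lam ≤ 4 * M := by
      have hk := kap_gt
      have h4 : lam ≤ 4 * |u| := by
        by_contra! hlt
        obtain ⟨h1, h2⟩ := abs_lt.1 (show |u| < lam / 4 by linarith)
        refine hmem ⟨?_, ?_⟩
        · have : 1 / 4 ≤ 2 * kap * w.re := by nlinarith
          nlinarith
        · nlinarith
      linarith
    have b4 : 1 ≤ 4 ^ N * M ^ N / lam ^ N := by
      rw [one_le_div (by positivity), ← mul_pow]
      gcongr
    have b0 : 0 ≤ (2 ^ N + N * N) * M ^ (2 * N) * D / lam ^ N := by positivity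
    calc _ ≤ D * (N * (N * M ^ N)) := by
          gcongr; exact norm_sum_truncCoeff_le hM hp hq hη1 N
      _ ≤ D * (N * (N * M ^ N)) * (4 ^ N * M ^ N / lam ^ N) := le_mul_of_one_le_right (by positivity) b4
      _ = N * N * 4 ^ N * M ^ (2 * N) * D / lam ^ N := by rw [two_mul, pow_add M]; ring
      _ ≤ N * N * 4 ^ N * M ^ (2 * N) * D / lam ^ N + (2 ^ N + N * N) * M ^ (2 * N) * D / lam ^ N := by
          linarith
      _ = _ := by ring

/-- The perturbed Gaussian is cut to the segment while the series is integrated over all of ℝ. The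
pointwise remainder bound covers both regions and does not involve `w`, hence the uniformity in `arg
y`. -/
lemma gaussSeg_expansion (N : ℕ) (R : ℝ) : ∃ K : ℝ, 0 ≤ K ∧ ∀ (x w : ℂ) (lam : ℝ), ‖x‖ ≤ R →
    ‖w‖ = 1 → 1 / 4 ≤ w.re → 1 ≤ lam →
    ‖gaussSeg x w lam - exp (x ^ 2 / 6) / momentNorm *
      ∑ n ∈ Finset.range N, A n x * (w / lam) ^ n‖ ≤ K / lam ^ N := by
  rcases lt_or_ge R 0 with hR | hR
  · exact ⟨0, le_rfl, fun x w lam hx => absurd ((norm_nonneg x).trans hx) (not_le.2 hR)⟩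
  obtain ⟨K, hK0, hK⟩ := exists_gaussian_dominates (8 * N) (4 * R) (c := 1 / 8) (by norm_num)
  have hint := (integrable_exp_neg_mul_sq (b := 1 / 8 / 2) (by norm_num)).const_mul K
  obtain ⟨Q, hQ⟩ : ∃ Q : ℝ, Q = (2 ^ N + N * N + N * N * 4 ^ N) * (5 + R) ^ (2 * N) := ⟨_, rfl⟩
  have hQ0 : 0 ≤ Q := by rw [hQ]; positivity
  refine ⟨Q * ∫ u : ℝ, K * Real.exp (-(1 / 8 / 2) * u ^ 2),
    mul_nonneg hQ0 (integral_nonneg fun u => by positivity), fun x w lam hx hw hwr hlam => ?_⟩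
  have hab : -(2 * kap * w.re * lam) ≤ kap * lam := by
    have := mul_pos kap_pos (by linarith : 0 < lam)
    nlinarith
  have hseg : gaussSeg x w lam = ∫ u : ℝ, (Set.Ioc (-(2 * kap * w.re * lam)) (kap * lam)).indicator
        (fun u : ℝ => baseGauss x u * exp (pert x (w / lam) u)) u := by
    rw [gaussSeg, intervalIntegral.integral_of_le hab, integral_indicator measurableSet_Ioc]
  have hi1 : Integrable ((Set.Ioc (-(2 * kap * w.re * lam)) (kap * lam)).indicator
        (fun u : ℝ => baseGauss x u * exp (pert x (w / lam) u))) := by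
    rw [integrable_indicator_iff measurableSet_Ioc]
    exact (continuous_baseGauss_mul_exp_pert x (w / lam)).integrableOn_Ioc
  have hi2 (n : ℕ) : Integrable fun u : ℝ => (w / lam) ^ n *
        (baseGauss x u * truncCoeff n (pertLin x u) (pertQuad u)) :=
    (integral_truncCoeff_pert n x).1.const_mul _
  have hsum : exp (x ^ 2 / 6) / momentNorm * ∑ n ∈ Finset.range N, A n x * (w / lam) ^ n
      = ∫ u : ℝ, ∑ n ∈ Finset.range N, (w / lam) ^ n *
        (baseGauss x u * truncCoeff n (pertLin x u) (pertQuad u)) := by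
    rw [integral_finsetSum _ fun n _ => hi2 n, Finset.mul_sum]
    refine Finset.sum_congr rfl fun n _ => ?_
    rw [integral_const_mul, (integral_truncCoeff_pert n x).2]
    ring
  rw [hseg, hsum, ← integral_sub hi1 (integrable_finsetSum _ fun n _ => hi2 n)]
  refine (norm_integral_le_of_norm_le (hint.const_mul (Q / lam ^ N))
    (Eventually.of_forall fun u => ?_)).trans (le_of_eq ?_)
  · refine (norm_gauss_remainder_le N hx hw hwr hlam u).trans ?_
    rw [← hQ]
    have hl : 0 < lam ^ N := by positivity
    exact mul_le_mul_of_nonneg_left (hK u) (by positivity)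
  · rw [integral_const_mul]; ring

/-! ### The local variable at the saddle point -/

/-- The exponent at the saddle point `t₁`. -/
def saddleExponent (x y : ℂ) : ℂ :=
  3 / 4 * kap * zeta ^ 4 * (cbrtNorm y * cbrtDir y.arg) ^ 4
    - x * kap ^ 2 * zeta ^ 2 * (cbrtNorm y * cbrtDir y.arg) ^ 2

/-- The phase `e^{-i(π+2θ)/3}` of the cubic term at the saddle point `t₁`. -/
def cubicDir (θ : ℝ) : ℂ := zeta⁻¹ ^ 2 * (cbrtDir θ)⁻¹ ^ 2

lemma norm_cubicDir (θ : ℝ) : ‖cubicDir θ‖ = 1 := by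
  rw [cubicDir, norm_mul, norm_pow, norm_pow, norm_inv, norm_inv, norm_zeta, norm_cbrtDir]
  norm_num

lemma cubicDir_re (θ : ℝ) : (cubicDir θ).re = Real.cos ((Real.pi + 2 * θ) / 3) := by
  have : cubicDir θ = exp (((-((Real.pi + 2 * θ) / 3) : ℝ) : ℂ) * I) := by
    rw [cubicDir, zeta, cbrtDir, ← Complex.exp_neg, ← Complex.exp_neg, ← Complex.exp_nat_mul,
      ← Complex.exp_nat_mul, ← Complex.exp_add]
    congr 1; push_cast; ring
  rw [this, Complex.exp_ofReal_mul_I_re, Real.cos_neg]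

/-- The exact Taylor expansion at `t₁`. The leading linear term cancels because `t₁` is a saddle
point, and the direction of `C₁` makes the quadratic coefficient real; the scaling `u = μ² r` frees
it of `y`. -/
lemma contourIntegrand_path₁ (x : ℂ) {y : ℂ} (hy : y ≠ 0) (r : ℝ) :
    contourIntegrand x y (path₁ y.arg r) = exp (saddleExponent x y) *
      (baseGauss x (cbrtNorm y ^ 2 * r) *
        exp (pert x (cubicDir y.arg / ((cbrtNorm y ^ 2 : ℝ) : ℂ)) (cbrtNorm y ^ 2 * r))) := by
  have hE := cbrtDir_ne_zero y.arg
  have hz := zeta_ne_zero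
  have hm : (cbrtNorm y : ℂ) ≠ 0 := ofReal_ne_zero.2 (cbrtNorm_pos hy).ne'
  have h4 : 4 * (kap : ℂ) ^ 3 = 1 := by exact_mod_cast four_kap_cube
  have h3 := zeta_cube
  have h6 := zeta_pow_six
  rw [contourIntegrand_eq x hy, quarticExp, baseGauss, ← Complex.exp_add, ← Complex.exp_add, path₁,
    saddle₁_eq, dir₁_eq, saddleExponent, pert, pertLin, pertQuad, cubicDir, ← h3]
  congr 1
  push_cast
  generalize cbrtDir y.arg = e at *
  generalize (cbrtNorm y : ℂ) = m at *
  generalize zeta = z at *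
  generalize (kap : ℂ) = k at *
  field_simp
  linear_combination (-(4 * m ^ 2 * e ^ 6 * z ^ 6 * r) - m ^ 2 * e ^ 8 * z ^ 8 * k) * h4

lemma segInt₁_eq (x : ℂ) {y : ℂ} (hy : y ≠ 0) : segInt₁ x y =
    exp (saddleExponent x y) * dir₁ y.arg / (cbrtNorm y : ℂ) ^ 2
      * gaussSeg x (cubicDir y.arg) (cbrtNorm y ^ 2) := by
  have hm := cbrtNorm_pos hy
  have hm2 : cbrtNorm y ^ 2 ≠ 0 := by positivity
  simp only [segInt₁, contourIntegrand_path₁ x hy]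
  rw [intervalIntegral.integral_mul_const, intervalIntegral.integral_const_mul,
    intervalIntegral.integral_comp_mul_left (fun u : ℝ => baseGauss x u *
      exp (pert x (cubicDir y.arg / ((cbrtNorm y ^ 2 : ℝ) : ℂ)) u)) hm2, gaussSeg, cubicDir_re,
    two_rpow_one_third, ← kap, Complex.real_smul,
    show cbrtNorm y ^ 2 * -(2 * kap * Real.cos ((Real.pi + 2 * y.arg) / 3))
      = -(2 * kap * Real.cos ((Real.pi + 2 * y.arg) / 3) * cbrtNorm y ^ 2) by ring,
    show cbrtNorm y ^ 2 * kap = kap * cbrtNorm y ^ 2 by ring]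
  push_cast
  ring

lemma inv_two_mul_momentNorm :
    Real.sqrt (Real.pi / 3) / (2 : ℝ) ^ (5 / 6 : ℝ) = 1 / (2 * momentNorm) := by
  have h : (2 : ℝ) ^ (1 / 6 : ℝ) * (2 : ℝ) ^ (5 / 6 : ℝ) = 2 := by
    rw [← Real.rpow_add (by norm_num)]; norm_num
  have h2 : Real.sqrt (Real.pi / 3) * Real.sqrt (3 / Real.pi) = 1 := by
    rw [← Real.sqrt_mul (by positivity), div_mul_div_cancel₀ (by norm_num)]
    simp [Real.pi_ne_zero]
  rw [momentNorm, div_eq_div_iff (by positivity) (by positivity)]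
  have h0 : (2 : ℝ) ^ (1 / 6 : ℝ) ≠ 0 := by positivity
  field_simp
  linear_combination 2 * h2 - h

lemma exp_eq_zeta_pow (n : ℕ) : exp (n * (I * (Real.pi : ℂ) / 6)) = zeta ^ n := by
  rw [zeta, ← Complex.exp_nat_mul]
  congr 1; push_cast; ring

lemma prefactor_one_eq (x : ℂ) {y : ℂ} (hy : y ≠ 0) : prefactor 1 x y =
    exp (saddleExponent x y) * exp (x ^ 2 / 6)
      / (2 * momentNorm * (cbrtNorm y * cbrtDir y.arg)) := by
  have h := inv_two_mul_momentNorm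
  have hc : ((Real.sqrt (Real.pi / 3) : ℝ) : ℂ) / (((2 : ℝ) ^ (5 / 6 : ℝ) : ℝ) : ℂ)
      = 1 / (2 * momentNorm) := by
    rw [← ofReal_div, h]; push_cast; ring
  have h4 : ((4 : ℝ) ^ (4 / 3 : ℝ))⁻¹ = kap ^ 4 := by
    rw [← four_rpow_one_third_inv, inv_pow, ← Real.rpow_natCast, ← Real.rpow_mul (by norm_num)]
    norm_num
  have h2 : ((4 : ℝ) ^ (2 / 3 : ℝ))⁻¹ = kap ^ 2 := by
    rw [← four_rpow_one_third_inv, inv_pow, ← Real.rpow_natCast, ← Real.rpow_mul (by norm_num)]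
    norm_num
  have hz4 := exp_eq_zeta_pow 4
  have hz2 := exp_eq_zeta_pow 2
  have e4 : exp (-(-1) ^ 1 * (2 * I * (Real.pi : ℂ) / 3)) = zeta ^ 4 := by
    rw [← hz4]; congr 1; push_cast; ring
  have e2 : exp (-(-1) ^ 1 * (I * (Real.pi : ℂ) / 3)) = zeta ^ 2 := by
    rw [← hz2]; congr 1; push_cast; ring
  rw [prefactor, cpow_one_third hy, cpow_two_thirds hy, cpow_four_thirds hy, e4, e2, ← div_div, hc,
    div_eq_mul_inv _ (((4 : ℝ) ^ (4 / 3 : ℝ) : ℝ) : ℂ), ← ofReal_inv, h4,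
    div_eq_mul_inv _ (((4 : ℝ) ^ (2 / 3 : ℝ) : ℝ) : ℂ), ← ofReal_inv, h2, Complex.exp_add,
    saddleExponent]
  have hk : 4 * (kap : ℂ) ^ 3 = 1 := by exact_mod_cast four_kap_cube
  have e : 3 * ((cbrtNorm y * cbrtDir y.arg) ^ 4 * ((kap ^ 4 : ℝ) : ℂ)) * zeta ^ 4
      - x * ((cbrtNorm y * cbrtDir y.arg) ^ 2 * ((kap ^ 2 : ℝ) : ℂ)) * zeta ^ 2
      = 3 / 4 * kap * zeta ^ 4 * (cbrtNorm y * cbrtDir y.arg) ^ 4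
        - x * kap ^ 2 * zeta ^ 2 * (cbrtNorm y * cbrtDir y.arg) ^ 2 := by
    push_cast
    linear_combination (3 / 4 * kap * zeta ^ 4 * (cbrtNorm y * cbrtDir y.arg) ^ 4) * hk
  rw [e, div_div, div_mul_eq_mul_div, one_mul]

lemma partialSum_one_eq (N : ℕ) (x : ℂ) {y : ℂ} (hy : y ≠ 0) : partialSum 1 N x y =
    zeta⁻¹ * ∑ n ∈ Finset.range N, A n x * (cubicDir y.arg / ((cbrtNorm y ^ 2 : ℝ) : ℂ)) ^ n := by
  rw [partialSum, Finset.mul_sum]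
  refine Finset.sum_congr rfl fun n _ => ?_
  have h1 : exp ((-1) ^ 1 * (2 * (n : ℂ) + 1) * (I * (Real.pi : ℂ) / 6)) = (zeta⁻¹) ^ (2 * n + 1) := by
    rw [inv_pow, ← exp_eq_zeta_pow, ← Complex.exp_neg]
    congr 1; push_cast; ring
  have h2 := cpow_eq hy (2 * n)
  push_cast at h2
  rw [h1, h2, cubicDir]
  push_cast
  rw [div_pow, mul_pow, mul_pow, ← pow_mul, ← pow_mul, ← pow_mul, inv_pow (cbrtDir y.arg)]
  field_simp
  ring

lemma segInt₁_expansion (N : ℕ) (R : ℝ) : ∃ C : ℝ, 0 ≤ C ∧ ∀ x y : ℂ, ‖x‖ ≤ R → y ≠ 0 →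
    1 ≤ cbrtNorm y → -(Real.pi / 2) ≤ y.arg → y.arg ≤ Real.pi / 8 →
      ‖y ^ (1 / 3 : ℂ) / 2 * segInt₁ x y - prefactor 1 x y * partialSum 1 N x y‖
        ≤ C * ‖prefactor 1 x y‖ * ‖y‖ ^ (-(2 * (N : ℝ) / 3)) := by
  obtain ⟨K, hK0, hK⟩ := gaussSeg_expansion N R
  have hmn := momentNorm_pos
  refine ⟨K * momentNorm * Real.exp (R ^ 2 / 6), by positivity, fun x y hx hy hm h1 h2 => ?_⟩
  have hm0 := cbrtNorm_pos hy
  have hwr : 1 / 4 ≤ (cubicDir y.arg).re := by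
    rw [cubicDir_re]
    have := Real.pi_pos
    have : Real.cos (5 * Real.pi / 12) ≤ Real.cos ((Real.pi + 2 * y.arg) / 3) :=
      Real.cos_le_cos_of_nonneg_of_le_pi (by linarith) (by linarith) (by linarith)
    linarith [cos_five_pi_div_twelve_bounds.1]
  have hb := hK x (cubicDir y.arg) (cbrtNorm y ^ 2) hx (norm_cubicDir _) hwr (one_le_pow₀ hm)
  have hpow : ‖y‖ ^ (-(2 * (N : ℝ) / 3)) = 1 / (cbrtNorm y ^ 2) ^ N := by
    have := norm_rpow_eq y (2 * N)
    push_cast at this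
    rw [Real.rpow_neg (norm_nonneg y), this, ← pow_mul, one_div]
  have hz := zeta_ne_zero
  have hE := cbrtDir_ne_zero y.arg
  have hmc : (cbrtNorm y : ℂ) ≠ 0 := ofReal_ne_zero.2 hm0.ne'
  have hmnc : (momentNorm : ℂ) ≠ 0 := ofReal_ne_zero.2 hmn.ne'
  have e : y ^ (1 / 3 : ℂ) / 2 * segInt₁ x y - prefactor 1 x y * partialSum 1 N x y
      = prefactor 1 x y * (momentNorm * exp (-(x ^ 2 / 6)) * zeta⁻¹) *
        (gaussSeg x (cubicDir y.arg) (cbrtNorm y ^ 2) - exp (x ^ 2 / 6) / momentNorm *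
      ∑ n ∈ Finset.range N, A n x * (cubicDir y.arg / ((cbrtNorm y ^ 2 : ℝ) : ℂ)) ^ n) := by
    rw [segInt₁_eq x hy, partialSum_one_eq N x hy, prefactor_one_eq x hy, cpow_one_third hy, dir₁_eq,
      Complex.exp_neg]
    have := exp_ne_zero (x ^ 2 / 6)
    field_simp
  have hexp : ‖exp (-(x ^ 2 / 6))‖ ≤ Real.exp (R ^ 2 / 6) := by
    rw [Complex.norm_exp]
    refine Real.exp_le_exp.2 ((re_le_norm _).trans ?_)
    rw [norm_neg, norm_div, norm_pow, RCLike.norm_ofNat]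
    gcongr
  rw [e, hpow, norm_mul, norm_mul, norm_mul, norm_mul, norm_inv, norm_zeta, Complex.norm_real,
    Real.norm_of_nonneg hmn.le, inv_one, mul_one]
  calc _ ≤ ‖prefactor 1 x y‖ * (momentNorm * Real.exp (R ^ 2 / 6)) * (K / (cbrtNorm y ^ 2) ^ N) := by
        gcongr
    _ = _ := by ring

/-! ### Complex conjugation -/

lemma conj_zeta : conj zeta = zeta⁻¹ := by
  rw [zeta, ← Complex.exp_conj, ← Complex.exp_neg]
  simp [conj_ofNat]

lemma conj_cbrtDir (θ : ℝ) : conj (cbrtDir θ) = (cbrtDir θ)⁻¹ := by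
  rw [cbrtDir, ← Complex.exp_conj, ← Complex.exp_neg]
  simp [conj_ofNat]

lemma arg_conj_of_ne {y : ℂ} (hy : y.arg ≠ Real.pi) : (conj y).arg = -y.arg := by
  rw [arg_conj, if_neg hy]

lemma cbrtNorm_conj (y : ℂ) : cbrtNorm (conj y) = cbrtNorm y := by
  rw [cbrtNorm, cbrtNorm, norm_conj]

/-- The reflection `t ↦ -conj t` carries `C₂` for `y` to `C₁` for `conj y`, reversing the parameter.
-/
lemma conj_path₂ (θ r : ℝ) : -conj (path₂ θ r) = path₁ (-θ) (-r) := by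
  have hz := zeta_ne_zero
  have h6 := zeta_pow_six
  rw [path₂, path₁, saddle₁_eq, saddle₂_eq, dir₁_eq, dir₂_eq, cbrtDir_neg]
  simp only [map_add, map_mul, map_pow, map_inv₀, conj_ofReal, conj_zeta, conj_cbrtDir]
  push_cast
  field_simp
  linear_combination (-kap : ℂ) * h6

lemma conj_dir₂ (θ : ℝ) : conj (dir₂ θ) = dir₁ (-θ) := by
  rw [dir₁_eq, dir₂_eq, cbrtDir_neg]
  simp only [map_mul, map_pow, map_inv₀, conj_zeta, conj_cbrtDir]

lemma conj_contourIntegrand (x : ℂ) {y : ℂ} (hy : y ≠ 0) (ha : y.arg ≠ Real.pi) (t : ℂ) :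
    conj (contourIntegrand x y t) = contourIntegrand (conj x) (conj y) (-conj t) := by
  have hy' : conj y ≠ 0 := (map_ne_zero _).2 hy
  rw [contourIntegrand_eq x hy, contourIntegrand_eq _ hy', quarticExp, quarticExp,
    ← Complex.exp_conj, arg_conj_of_ne ha, cbrtNorm_conj, cbrtDir_neg]
  congr 1
  simp only [map_add, map_sub, map_neg, map_mul, map_pow, conj_ofReal, conj_cbrtDir, conj_I]
  ring

lemma conj_cpow_conj {y : ℂ} (ha : y.arg ≠ Real.pi) {s : ℂ} (hs : conj s = s) :
    conj (conj y ^ s) = y ^ s := by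
  rw [← cpow_conj _ _ ha, hs]

lemma conj_conj_line (x : ℂ) {y : ℂ} (hy : y ≠ 0) (ha : y.arg ≠ Real.pi) (r : ℝ) :
    conj (contourIntegrand x y (path₂ y.arg r) * dir₂ y.arg)
      = contourIntegrand (conj x) (conj y) (path₁ (conj y).arg (-r)) * dir₁ (conj y).arg := by
  rw [map_mul, conj_contourIntegrand x hy ha, conj_path₂, conj_dir₂, arg_conj_of_ne ha]

lemma conj_segInt₂ (x : ℂ) {y : ℂ} (hy : y ≠ 0) (ha : y.arg ≠ Real.pi) :
    conj (segInt₂ x y) = segInt₁ (conj x) (conj y) := by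
  rw [segInt₂, ← intervalIntegral.intervalIntegral_conj]
  simp only [conj_conj_line x hy ha]
  rw [intervalIntegral.integral_comp_neg (fun r : ℝ => contourIntegrand (conj x) (conj y)
    (path₁ (conj y).arg r) * dir₁ (conj y).arg), neg_neg, segInt₁, arg_conj_of_ne ha]
  congr 5
  ring

lemma conj_P (x y : ℂ) : conj (P x y) = P (conj x) (conj y) := by
  rw [P, P, ← integral_conj]
  congr 1; ext t
  simp only [pearceyIntegrand, map_mul, ← Complex.exp_conj, ← Complex.cos_conj, map_sub, map_neg,
    map_pow, conj_ofReal]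

lemma ne_zero_of_lt_arg {y : ℂ} (h : Real.pi / 8 < y.arg) : y ≠ 0 := by
  rintro rfl
  rw [arg_zero] at h
  linarith [Real.pi_pos]

lemma arg_ne_pi_of_le {y : ℂ} (h : y.arg ≤ Real.pi / 2) : y.arg ≠ Real.pi := by
  intro e
  rw [e] at h
  linarith [Real.pi_pos]

lemma integrable_line₂ (x y : ℂ) (h1 : Real.pi / 8 < y.arg) (h2 : y.arg ≤ Real.pi / 2) :
    Integrable fun r : ℝ => contourIntegrand x y (path₂ y.arg r) * dir₂ y.arg := by
  have hy := ne_zero_of_lt_arg h1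
  have ha := arg_ne_pi_of_le h2
  have e := arg_conj_of_ne ha
  have h := (integrable_line₁ (conj x) (conj y) (by rw [e]; linarith) (by rw [e]; linarith)).comp_neg
  simp only [← conj_conj_line x hy ha] at h
  have h' := (RCLike.conjLIE (K := ℂ)).toContinuousLinearEquiv.toContinuousLinearMap.integrable_comp h
  refine h'.congr (Eventually.of_forall fun r => ?_)
  exact conj_conj _

lemma conj_P₂ (x : ℂ) {y : ℂ} (hy : y ≠ 0) (ha : y.arg ≠ Real.pi) :
    conj (P₂ x y) = P₁ (conj x) (conj y) := by
  have e := arg_conj_of_ne ha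
  have hc : conj (y ^ (1 / 3 : ℂ)) = conj y ^ (1 / 3 : ℂ) := by
    rw [← conj_cpow_conj ha (by simp [conj_ofNat]), conj_conj]
  by_cases h : Real.pi / 8 < y.arg
  · rw [P₁, P₂, if_pos h, if_pos (by rw [e]; linarith), map_mul, map_div₀, hc, ← integral_conj]
    simp only [conj_conj_line x hy ha]
    rw [integral_neg_eq_self (fun r : ℝ => contourIntegrand (conj x) (conj y)
      (path₁ (conj y).arg r) * dir₁ (conj y).arg) volume]
    simp [conj_ofNat]
  · rw [P₁, P₂, if_neg h, if_neg (by rw [e]; linarith), map_mul, map_div₀, hc, ← segInt₁, ← segInt₂,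
      conj_segInt₂ x hy ha]
    simp [conj_ofNat]

lemma P_eq_P₂ (x y : ℂ) (h1 : Real.pi / 8 < y.arg) (h2 : y.arg ≤ Real.pi / 2) :
    P x y = P₂ x y := by
  have hy := ne_zero_of_lt_arg h1
  have ha := arg_ne_pi_of_le h2
  have e := arg_conj_of_ne ha
  have h := P_eq_P₁ (conj x) (conj y) (by rw [e]; linarith) (by rw [e]; linarith)
  rw [← conj_P, ← conj_P₂ x hy ha] at h
  exact (starRingEnd ℂ).injective h

lemma conj_A (n : ℕ) (x : ℂ) : conj (A n x) = A n (conj x) := by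
  obtain ⟨p, hp⟩ := exists_polynomial_A n
  rw [hp, hp, Polynomial.aeval_conj]

lemma conj_prefactor_two (x : ℂ) {y : ℂ} (ha : y.arg ≠ Real.pi) :
    conj (prefactor 2 x y) = prefactor 1 (conj x) (conj y) := by
  have hc (s : ℂ) (hs : conj s = s) : conj (y ^ s) = conj y ^ s := by
    rw [← conj_cpow_conj ha hs, conj_conj]
  simp only [prefactor, map_mul, map_div₀, ← Complex.exp_conj, map_add, map_sub, map_pow, map_neg,
    conj_ofReal, hc (1 / 3) (by simp [conj_ofNat]), hc (2 / 3) (by simp [conj_ofNat]), hc (4 / 3) (by simp [conj_ofNat]), conj_I, conj_ofNat,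
    map_one]
  congr 6 <;> ring_nf

lemma conj_partialSum_two (N : ℕ) (x : ℂ) {y : ℂ} (ha : y.arg ≠ Real.pi) :
    conj (partialSum 2 N x y) = partialSum 1 N (conj x) (conj y) := by
  rw [partialSum, partialSum, map_sum]
  refine Finset.sum_congr rfl fun n _ => ?_
  have hc : conj (y ^ (2 * (n : ℂ) / 3)) = conj y ^ (2 * (n : ℂ) / 3) := by
    rw [← conj_cpow_conj ha (by simp [conj_ofNat]), conj_conj]
  rw [map_mul, map_div₀, hc, conj_A, ← Complex.exp_conj]
  simp only [map_add, map_mul, map_pow, map_neg, map_div₀, conj_ofReal, conj_I, conj_ofNat,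
    map_one, map_natCast]
  congr 2; ring

/-! ### The expansions -/

lemma saddleExponent_re_bounds {x y : ℂ} {R : ℝ} (hx : ‖x‖ ≤ R) :
    |(saddleExponent x y).re - 3 / 4 * kap * cbrtNorm y ^ 4 *
      Real.cos (2 * Real.pi / 3 + 4 * y.arg / 3)| ≤ R * cbrtNorm y ^ 2 := by
  have hm : 0 ≤ cbrtNorm y := Real.rpow_nonneg (norm_nonneg y) _
  have e : 3 / 4 * kap * zeta ^ 4 * (cbrtNorm y * cbrtDir y.arg) ^ 4
      = ((3 / 4 * kap * cbrtNorm y ^ 4 : ℝ) : ℂ) *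
        exp (((2 * Real.pi / 3 + 4 * y.arg / 3 : ℝ) : ℂ) * I) := by
    have : exp (((2 * Real.pi / 3 + 4 * y.arg / 3 : ℝ) : ℂ) * I) = zeta ^ 4 * cbrtDir y.arg ^ 4 := by
      rw [zeta, cbrtDir, ← Complex.exp_nat_mul, ← Complex.exp_nat_mul, ← Complex.exp_add]
      congr 1; push_cast; ring
    rw [this]; push_cast; ring
  rw [saddleExponent, e, sub_re, Complex.re_ofReal_mul, Complex.exp_ofReal_mul_I_re, sub_sub_cancel_left,
    abs_neg]
  refine (abs_re_le_norm _).trans ?_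
  simp only [norm_mul, norm_pow, norm_zeta, norm_cbrtDir, Complex.norm_real, one_pow, mul_one,
    Real.norm_of_nonneg kap_pos.le, Real.norm_of_nonneg hm]
  have hk : kap ^ 2 ≤ 1 := pow_le_one₀ kap_pos.le kap_lt_one.le
  calc ‖x‖ * kap ^ 2 * cbrtNorm y ^ 2 ≤ R * 1 * cbrtNorm y ^ 2 := by
        have := (norm_nonneg x).trans hx
        gcongr
    _ = _ := by ring

/-- The difference of the cosines is `-√3 sin(4θ/3)`, at least `√3/2` in this range. It measures how
far the saddle `t₁` dominates `t₂`. -/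
lemma cos_gap {θ : ℝ} (h1 : -(Real.pi / 2) ≤ θ) (h2 : θ ≤ -(Real.pi / 8)) :
    Real.cos (2 * Real.pi / 3 - 4 * θ / 3) + 4 / 5 ≤ Real.cos (2 * Real.pi / 3 + 4 * θ / 3) := by
  have hp := Real.pi_pos
  have hs : 1 / 2 ≤ -Real.sin (4 * θ / 3) := by
    have : Real.cos (Real.pi / 3) ≤ Real.cos (-(4 * θ / 3) - Real.pi / 2) := by
      rw [← Real.cos_abs (-(4 * θ / 3) - Real.pi / 2)]
      refine Real.cos_le_cos_of_nonneg_of_le_pi (abs_nonneg _) (by linarith) ?_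
      exact abs_le.2 ⟨by linarith, by linarith⟩
    rwa [Real.cos_pi_div_three, Real.cos_sub_pi_div_two, Real.sin_neg] at this
  have hs3 : Real.sin (2 * Real.pi / 3) = √3 / 2 := by
    rw [← Real.sin_pi_div_three, ← Real.sin_pi_sub (Real.pi / 3)]
    congr 1; ring
  have h3 : 1.7 < √3 := Real.lt_sqrt_of_sq_lt (by norm_num)
  rw [Real.cos_sub, Real.cos_add, hs3]
  nlinarith

/-- The contributions other than that of the first segment are exponentially small. -/
lemma norm_P_sub_segInt₁_le (R : ℝ) : ∃ K : ℝ, 0 ≤ K ∧ ∀ x y : ℂ, ‖x‖ ≤ R → y ≠ 0 →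
    1 ≤ cbrtNorm y → 2 * R ≤ cbrtNorm y ^ 2 → -(Real.pi / 2) ≤ y.arg → y.arg ≤ -(Real.pi / 8) →
    ‖P x y - y ^ (1 / 3 : ℂ) / 2 * segInt₁ x y‖ ≤ K * cbrtNorm y *
      Real.exp ((saddleExponent x y).re - 3 / 10 * cbrtNorm y ^ 4 + 5 * R * cbrtNorm y ^ 2) := by
  obtain ⟨K, hK0, hK⟩ := norm_gaussSeg_le R
  refine ⟨K + 1, by positivity, fun x y hx hy hm hmR h1 h2 => ?_⟩
  have hp := Real.pi_pos
  have hR : 0 ≤ R := (norm_nonneg x).trans hx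
  have ha : y.arg ≠ Real.pi := by intro e; rw [e] at h2; linarith
  have hk := kap_gt
  have b1 := norm_tailInt_le h1 (by linarith) hy hx hmR
  have b2 := norm_tailInt'_le h1 (by linarith) hy hx hmR
  have c1 := half_le_tailHeight h1 (by linarith)
  have c2 := half_le_tailHeight (θ := -y.arg) (by linarith) (by linarith)
  obtain ⟨d1, d2⟩ := abs_le.1 (saddleExponent_re_bounds (y := y) hx)
  have hxc : ‖conj x‖ ≤ R := by rwa [norm_conj]
  obtain ⟨d3, d4⟩ := abs_le.1 (saddleExponent_re_bounds (y := conj y) hxc)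
  -- Hence `Re saddleExponent ≥ -R μ²`, whereas the tails are at most `exp(-μ⁴/2 + 4Rμ²)`.
  have hcos : 0 ≤ Real.cos (2 * Real.pi / 3 + 4 * y.arg / 3) :=
    Real.cos_nonneg_of_mem_Icc ⟨by linarith, by linarith⟩
  have hgap := cos_gap h1 h2
  have hseg : ‖segInt₂ x y‖
      = Real.exp (saddleExponent (conj x) (conj y)).re / cbrtNorm y ^ 2
        * ‖gaussSeg (conj x) (cubicDir (conj y).arg) (cbrtNorm y ^ 2)‖ := by
    rw [← norm_conj, conj_segInt₂ x hy ha, segInt₁_eq _ ((map_ne_zero _).2 hy), norm_mul, norm_div,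
      norm_mul, norm_dir₁, Complex.norm_exp, mul_one, cbrtNorm_conj, norm_pow, Complex.norm_real,
      Real.norm_of_nonneg (by linarith)]
  have hwr : -(1 / 2) ≤ (cubicDir (conj y).arg).re := by
    rw [cubicDir_re, arg_conj_of_ne ha, ← Real.cos_pi_div_three, ← Real.cos_pi_sub]
    exact Real.cos_le_cos_of_nonneg_of_le_pi (by linarith) (by linarith) (by linarith)
  have hg := hK (conj x) (cubicDir (conj y).arg) (cbrtNorm y ^ 2) hxc (norm_cubicDir _) hwr
    (one_le_pow₀ hm)
  rw [cbrtNorm_conj, arg_conj_of_ne ha,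
    show 2 * Real.pi / 3 + 4 * -y.arg / 3 = 2 * Real.pi / 3 - 4 * y.arg / 3 by ring] at d3 d4
  set μ := cbrtNorm y with hμ
  have hμ2 : 1 ≤ μ ^ 2 := one_le_pow₀ hm
  have hμ4 : 1 ≤ μ ^ 4 := one_le_pow₀ hm
  have hRμ : 0 ≤ R * μ ^ 2 := by positivity
  obtain ⟨T, hT⟩ : ∃ T, T = Real.exp ((saddleExponent x y).re - 3 / 10 * μ ^ 4 + 5 * R * μ ^ 2) :=
    ⟨_, rfl⟩
  have hT0 : 0 ≤ T := hT ▸ Real.exp_nonneg _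
  have htail : ∀ H : ℝ, 1 / 2 ≤ H → Real.exp (-(μ ^ 4 * H) + 4 * R * μ ^ 2) / μ ^ 4 ≤ T := by
    intro H hH
    refine (div_le_self (Real.exp_nonneg _) hμ4).trans (hT ▸ Real.exp_le_exp.2 ?_)
    have a1 : μ ^ 4 * (1 / 2) ≤ μ ^ 4 * H := by gcongr
    have a2 : 0 ≤ 3 / 4 * kap * μ ^ 4 * Real.cos (2 * Real.pi / 3 + 4 * y.arg / 3) := by positivity
    linarith
  have hS : Real.exp (saddleExponent (conj x) (conj y)).re ≤ T := by
    refine hT ▸ Real.exp_le_exp.2 ?_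
    have a1 := mul_le_mul_of_nonneg_left hgap (by positivity : 0 ≤ 3 / 4 * kap * μ ^ 4)
    have a2 : 3 / 10 * μ ^ 4 ≤ 3 / 4 * kap * μ ^ 4 * (4 / 5) := by nlinarith
    linarith
  have hseg2 : ‖segInt₂ x y‖ ≤ T * K := by
    rw [hseg]
    have : Real.exp (saddleExponent (conj x) (conj y)).re / μ ^ 2 ≤ T :=
      (div_le_self (Real.exp_nonneg _) hμ2).trans hS
    gcongr
  have e : P x y - y ^ (1 / 3 : ℂ) / 2 * segInt₁ x y
      = μ * cbrtDir y.arg / 2 * segInt₂ x y + μ / 2 * (tailInt x y + tailInt' x y) := by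
    rw [P_eq_segInt_add_tailInt x hy, cpow_one_third hy]; ring
  rw [e, ← hT]
  refine (norm_add_le _ _).trans ?_
  rw [norm_mul, norm_mul, norm_div, norm_div, norm_mul, norm_cbrtDir, Complex.norm_real,
    Real.norm_of_nonneg (by linarith), RCLike.norm_ofNat, mul_one]
  have f1 : μ / 2 * ‖segInt₂ x y‖ ≤ μ * (T * K) := by gcongr; linarith
  have f2 : μ / 2 * ‖tailInt x y + tailInt' x y‖ ≤ μ / 2 * (T + T) := by
    gcongr
    exact norm_add_le_of_le (b1.trans (htail _ c1)) (b2.trans (htail _ c2))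
  linarith

/-- A lower bound, needed to restate exponentially small errors relative to the prefactor. -/
lemma exists_le_norm_prefactor (R : ℝ) : ∃ k : ℝ, 0 < k ∧ ∀ x y : ℂ, ‖x‖ ≤ R → y ≠ 0 →
    k * Real.exp (saddleExponent x y).re / cbrtNorm y ≤ ‖prefactor 1 x y‖ := by
  have hm := momentNorm_pos
  refine ⟨Real.exp (-(R ^ 2 / 6)) / (2 * momentNorm), by positivity, fun x y hx hy => ?_⟩
  have hy0 := cbrtNorm_pos hy
  rw [prefactor_one_eq x hy, norm_div, norm_mul, norm_mul, norm_mul, norm_mul, norm_cbrtDir,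
    Complex.norm_exp, Complex.norm_exp, Complex.norm_real, Complex.norm_real,
    Real.norm_of_nonneg hm.le, Real.norm_of_nonneg hy0.le, RCLike.norm_ofNat, mul_one]
  have h : Real.exp (-(R ^ 2 / 6)) ≤ Real.exp (x ^ 2 / 6).re := by
    refine Real.exp_le_exp.2 (neg_le.1 ((neg_le_abs _).trans ((abs_re_le_norm _).trans ?_)))
    rw [norm_div, norm_pow, RCLike.norm_ofNat]
    gcongr
  calc _ = Real.exp (saddleExponent x y).re * Real.exp (-(R ^ 2 / 6))
        / (2 * momentNorm * cbrtNorm y) := by field_simp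
    _ ≤ _ := by gcongr

lemma P₁_expansion (N : ℕ) (R : ℝ) : ∃ C Y : ℝ, 0 < Y ∧ ∀ x y : ℂ, ‖x‖ ≤ R → Y ≤ ‖y‖ →
      -(Real.pi / 2) ≤ y.arg → y.arg ≤ Real.pi / 8 →
        ‖P₁ x y - prefactor 1 x y * partialSum 1 N x y‖
          ≤ C * ‖prefactor 1 x y‖ * ‖y‖ ^ (-(2 * (N : ℝ) / 3)) := by
  obtain ⟨C, hC0, hC⟩ := segInt₁_expansion N R
  obtain ⟨K, hK0, hK⟩ := norm_P_sub_segInt₁_le R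
  obtain ⟨k, hk0, hk⟩ := exists_le_norm_prefactor R
  -- Applied at `u = μ²`. Of the `N + 1` powers of `μ²`, `N` give the required rate and one makes up
  -- for the factor `μ` in the error and the `1/μ` in the lower bound of the prefactor.
  obtain ⟨D, hD0, hD⟩ := exists_gaussian_dominates (N + 1) (5 * R) (c := 3 / 10) (by norm_num)
  obtain ⟨Y, hY0, hY⟩ := exists_le_cbrtNorm (max 1 (2 * R))
  refine ⟨C + K * D / k, Y, hY0, fun x y hx hy h1 h2 => ?_⟩
  obtain ⟨hM, hy0⟩ := hY y hy
  obtain ⟨hm, hmR⟩ := max_le_iff.1 hM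
  have hp := Real.pi_pos
  have hexp := hC x y hx hy0 hm h1 h2
  have hpow : ‖y‖ ^ (-(2 * (N : ℝ) / 3)) = 1 / (cbrtNorm y ^ 2) ^ N := by
    have := norm_rpow_eq y (2 * N)
    push_cast at this
    rw [Real.rpow_neg (norm_nonneg y), this, ← pow_mul, one_div]
  rw [add_mul, add_mul]
  by_cases ha : y.arg < -(Real.pi / 8)
  · rw [← P_eq_P₁ x y h1 ha]
    have hsmall := hK x y hx hy0 hm (by nlinarith) h1 ha.le
    have hpre := hk x y hx hy0
    have e : P x y - prefactor 1 x y * partialSum 1 N x y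
        = (y ^ (1 / 3 : ℂ) / 2 * segInt₁ x y - prefactor 1 x y * partialSum 1 N x y)
          + (P x y - y ^ (1 / 3 : ℂ) / 2 * segInt₁ x y) := by ring
    rw [e]
    refine norm_add_le_of_le hexp (hsmall.trans ?_)
    rw [hpow]
    have hm0 := cbrtNorm_pos hy0
    generalize (saddleExponent x y).re = s at *
    generalize ‖prefactor 1 x y‖ = p at *
    set μ := cbrtNorm y
    have hd := hD (μ ^ 2)
    rw [abs_of_nonneg (by positivity)] at hd
    have hd2 : (μ ^ 2) ^ (N + 1) * Real.exp (-(3 / 10) * (μ ^ 2) ^ 2 + 5 * R * μ ^ 2) ≤ D := by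
      calc _ ≤ (1 + μ ^ 2) ^ (N + 1) * Real.exp (-(3 / 10) * (μ ^ 2) ^ 2 + 5 * R * μ ^ 2) := by
            gcongr; linarith
        _ ≤ D * Real.exp (-(3 / 10 / 2) * (μ ^ 2) ^ 2) := hd
        _ ≤ D * 1 := by
            gcongr
            exact Real.exp_le_one_iff.2 (by nlinarith [sq_nonneg (μ ^ 2)])
        _ = D := mul_one D
    have hE : Real.exp (s - 3 / 10 * μ ^ 4 + 5 * R * μ ^ 2)
        = Real.exp s * Real.exp (-(3 / 10) * (μ ^ 2) ^ 2 + 5 * R * μ ^ 2) := by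
      rw [← Real.exp_add]; ring_nf
    have hG0 := Real.exp_nonneg (-(3 / 10) * (μ ^ 2) ^ 2 + 5 * R * μ ^ 2)
    rw [hE]
    generalize Real.exp (-(3 / 10) * (μ ^ 2) ^ 2 + 5 * R * μ ^ 2) = G at *
    have hs : Real.exp s / μ ≤ p / k := by
      rw [le_div_iff₀ hk0]
      calc _ = k * Real.exp s / μ := by ring
        _ ≤ p := hpre
    have hp0 : 0 ≤ p := le_trans (by positivity) hpre
    calc K * μ * (Real.exp s * G)
        = K * (Real.exp s / μ) * ((μ ^ 2) ^ (N + 1) * G) * (1 / (μ ^ 2) ^ N) := by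
          rw [pow_succ]
          field_simp
      _ ≤ K * (p / k) * D * (1 / (μ ^ 2) ^ N) := by gcongr
      _ = K * D / k * p * (1 / (μ ^ 2) ^ N) := by ring
  · rw [P₁, if_neg ha, ← segInt₁]
    refine hexp.trans (le_add_of_nonneg_right ?_)
    positivity

lemma P₂_expansion (N : ℕ) (R : ℝ) : ∃ C Y : ℝ, 0 < Y ∧ ∀ x y : ℂ, ‖x‖ ≤ R → Y ≤ ‖y‖ →
      -(Real.pi / 8) ≤ y.arg → y.arg ≤ Real.pi / 2 →
        ‖P₂ x y - prefactor 2 x y * partialSum 2 N x y‖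
          ≤ C * ‖prefactor 2 x y‖ * ‖y‖ ^ (-(2 * (N : ℝ) / 3)) := by
  obtain ⟨C, Y, hY, h⟩ := P₁_expansion N R
  refine ⟨C, Y, hY, fun x y hx hy h1 h2 => ?_⟩
  have hy0 : y ≠ 0 := norm_pos_iff.1 (hY.trans_le hy)
  have ha := arg_ne_pi_of_le h2
  have e := arg_conj_of_ne ha
  have := h (conj x) (conj y) (by rwa [norm_conj]) (by rwa [norm_conj]) (by rw [e]; linarith)
    (by rw [e]; linarith)
  rwa [← conj_P₂ x hy0 ha, ← conj_prefactor_two x ha, ← conj_partialSum_two N x ha, ← map_mul,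
    ← map_sub, norm_conj, norm_conj, norm_conj] at this

end Pearcey

end

theorem mainTheorem1 :
    -- convergence of the integrals that define `P`, `P₁`, `P₂` and `c_n`
    (∀ x y : ℂ, MeasureTheory.IntegrableOn (Pearcey.pearceyIntegrand x y) (Set.Ioi 0)) ∧
    (∀ x y : ℂ, -(Real.pi / 2) ≤ y.arg → y.arg < -(Real.pi / 8) →
      MeasureTheory.Integrable fun r : ℝ =>
        Pearcey.contourIntegrand x y (Pearcey.path₁ y.arg r) * Pearcey.dir₁ y.arg) ∧
    (∀ x y : ℂ, Real.pi / 8 < y.arg → y.arg ≤ Real.pi / 2 →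
      MeasureTheory.Integrable fun r : ℝ =>
        Pearcey.contourIntegrand x y (Pearcey.path₂ y.arg r) * Pearcey.dir₂ y.arg) ∧
    (∀ (n : ℕ) (x : ℂ), MeasureTheory.Integrable (Pearcey.momentIntegrand n x)) ∧
    -- the three cases for `P`
    (∀ δ : ℝ, δ < Pearcey.κ → ∀ R : ℝ, ∃ C Y : ℝ, 0 < Y ∧ ∀ x y : ℂ, ‖x‖ ≤ R → Y ≤ ‖y‖ →
      |y.arg| ≤ Real.pi / 8 →
        ‖Pearcey.P x y - (Pearcey.P₁ x y + Pearcey.P₂ x y)‖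
          ≤ C * Real.exp (-δ * ‖y‖ ^ (4 / 3 : ℝ))) ∧
    (1.38076 < Pearcey.κ ∧ Pearcey.κ < 1.38077) ∧
    (∀ x y : ℂ, -(Real.pi / 2) ≤ y.arg → y.arg < -(Real.pi / 8) →
      Pearcey.P x y = Pearcey.P₁ x y) ∧
    (∀ x y : ℂ, Real.pi / 8 < y.arg → y.arg ≤ Real.pi / 2 →
      Pearcey.P x y = Pearcey.P₂ x y) ∧
    -- the complete asymptotic expansions of `P₁` and `P₂`
    (∀ (N : ℕ) (R : ℝ), ∃ C Y : ℝ, 0 < Y ∧ ∀ x y : ℂ, ‖x‖ ≤ R → Y ≤ ‖y‖ →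
      -(Real.pi / 2) ≤ y.arg → y.arg ≤ Real.pi / 8 →
        ‖Pearcey.P₁ x y - Pearcey.prefactor 1 x y * Pearcey.partialSum 1 N x y‖
          ≤ C * ‖Pearcey.prefactor 1 x y‖ * ‖y‖ ^ (-(2 * (N : ℝ) / 3))) ∧
    (∀ (N : ℕ) (R : ℝ), ∃ C Y : ℝ, 0 < Y ∧ ∀ x y : ℂ, ‖x‖ ≤ R → Y ≤ ‖y‖ →
      -(Real.pi / 8) ≤ y.arg → y.arg ≤ Real.pi / 2 →
        ‖Pearcey.P₂ x y - Pearcey.prefactor 2 x y * Pearcey.partialSum 2 N x y‖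
          ≤ C * ‖Pearcey.prefactor 2 x y‖ * ‖y‖ ^ (-(2 * (N : ℝ) / 3))) ∧
    -- the coefficients: closed form and recurrence for `c_n`, polynomiality of `A_n`
    (∀ (n : ℕ) (x : ℂ),
      Pearcey.c n x = 1 / (3 ^ n * (((2 : ℝ) ^ ((n : ℝ) / 3) : ℝ) : ℂ)) *
        ∑ k ∈ Finset.range (n / 2 + 1), (3 / 2) ^ k * x ^ (n - 2 * k) *
          ((n.factorial : ℂ) / ((k.factorial : ℂ) * ((n - 2 * k).factorial : ℂ)))) ∧
    (∀ x : ℂ, Pearcey.c 0 x = 1) ∧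
    (∀ x : ℂ, Pearcey.c 1 x = x / (3 * (((2 : ℝ) ^ (1 / 3 : ℝ) : ℝ) : ℂ))) ∧
    (∀ (n : ℕ) (x : ℂ),
      Pearcey.c (n + 2) x = x / (3 * (((2 : ℝ) ^ (1 / 3 : ℝ) : ℝ) : ℂ)) * Pearcey.c (n + 1) x
        + ((n : ℂ) + 1) / (3 * (((2 : ℝ) ^ (2 / 3 : ℝ) : ℝ) : ℂ)) * Pearcey.c n x) ∧
    (∀ n : ℕ, ∃ p : Polynomial ℝ, ∀ x : ℂ, Pearcey.A n x = Polynomial.aeval x p) :=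
  ⟨Pearcey.integrableOn_pearceyIntegrand, Pearcey.integrable_line₁, Pearcey.integrable_line₂,
    Pearcey.integrable_momentIntegrand, Pearcey.norm_P_sub_le, Pearcey.κ_bounds, Pearcey.P_eq_P₁,
    Pearcey.P_eq_P₂, Pearcey.P₁_expansion, Pearcey.P₂_expansion, Pearcey.c_closed_form,
    Pearcey.c_zero, Pearcey.c_one, Pearcey.c_succ_succ, Pearcey.exists_polynomial_A⟩
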